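/- **Setting.** Let $n\ge 1$ be odd, let $\mathbb F_q$ be a finite field with $\mathrm{char}(\mathbb F_q)\nmid 4n$ and $q\equiv 3 \pmod 4$, and let $Q_n=\langle a,b \mid a^{2n}=1,\ b^2=a^n,\ b^{-1}ab=a^{-1}\rangle$ be the generalised quaternion group of order $4n$. For $g\in\mathbb F_q[x]$ with $g(0)\ne0$ put $g^*(x)=g(0)^{-1}x^{\deg g}g(x^{-1})$. Factor into monic irreducibles over $\mathbb F_q$ $$x^n-1=f_1\cdots f_r\, f_{r+1}f_{r+1}^*\cdots f_{r+s}f_{r+s}^*,\qquad x^n+1=g_1\cdots g_t\, g_{t+1}g_{t+1}^*\cdots g_{t+k}g_{t+k}^*,$$ with $f_1=x-1$, $g_1=x+1$, $f_i=f_i^*$ for $i\le r$ and $g_j=g_j^*$ for $j\le t$. In an extension field of $\mathbb F_q$ choose a root $\alpha_i$ of each $f_i$, a root $\beta_j$ of each $g_j$ and an element $\iota$ with $\iota^2=-1$. For $2\le j\le t$ with $4\nmid\deg g_j$ choose $u_j,v_j\in\mathbb F_q(\beta_j+\beta_j^{-1})$ with $u_j^2+v_j^2=-1$. Put * $A_1=\mathbb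 F_q\oplus\mathbb F_q$; $A_i=\mathcal M_2(\mathbb F_q(\alpha_i+\alpha_i^{-1}))$ for $2\le i\le r$; $A_i=\mathcal M_2(\mathbb F_q(\alpha_i))$ for $r<i\le r+s$; * $B_1=\mathbb F_q(\iota)$; $B_j=\mathcal M_2(\mathbb F_q(\beta_j+\beta_j^{-1}))$ for $2\le j\le t$; $B_j=\mathcal M_2(\mathbb F_q(\beta_j))$ for $t<j\le t+k$. **The isomorphism.** There is an isomorphism of $\mathbb F_q$-algebras $\psi:\mathbb F_q[Q_n]\to\bigoplus_{i=1}^{r+s}A_i\oplus\bigoplus_{j=1}^{t+k}B_j$ whose components on the generators are: * $A_1$: $a\mapsto(1,1)$, $b\mapsto(1,-1)$; * $A_i$, $2\le i\le r$: $a\mapsto Z_i^{-1}\left[\begin{smallmatrix}\alpha_i&0\\0&\alpha_i^{-1}\end{smallmatrix}\right]Z_i$, $b\mapsto Z_i^{-1}\left[\begin{smallmatrix}0&1\\1&0\end{smallmatrix}\right]Z_i$ with $Z_i=\left[\begin{smallmatrix}1&-\alpha_i\\1&-\alpha_i^{-1}\end{smallmatrix}\right]$; * $A_i$, $i>r$: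 $a\mapsto\left[\begin{smallmatrix}\alpha_i&0\\0&\alpha_i^{-1}\end{smallmatrix}\right]$, $b\mapsto\left[\begin{smallmatrix}0&1\\1&0\end{smallmatrix}\right]$; * $B_1$: $a\mapsto-1$, $b\mapsto\iota$; * $B_j$, $2\le j\le t$, $4\mid\deg g_j$: $a\mapsto W_j^{-1}\left[\begin{smallmatrix}\beta_j&0\\0&\beta_j^{-1}\end{smallmatrix}\right]W_j$, $b\mapsto W_j^{-1}\left[\begin{smallmatrix}0&\iota\\\iota&0\end{smallmatrix}\right]W_j$ with $W_j=\left[\begin{smallmatrix}\iota&-\beta_j\\\iota&-\beta_j^{-1}\end{smallmatrix}\right]$; * $B_j$, $2\le j\le t$, $4\nmid\deg g_j$: $a\mapsto\theta_j\left(\left[\begin{smallmatrix}\beta_j&0\\0&\beta_j^{-1}\end{smallmatrix}\right]\right)$, $b\mapsto\theta_j\left(\left[\begin{smallmatrix}0&\iota\\\iota&0\end{smallmatrix}\right]\right)$, where $$\theta_j:\begin{bmatrix}x_1+x_2\iota&x_3+x_4\iota\\-(x_3-x_4\iota)&x_1-x_2\iota\end{bmatrix}\mapsto\begin{bmatrix}x_1+x_2u_j-x_4v_j&x_3+x_2v_j+x_4u_j\\-x_3+x_2v_j+x_4u_j&x_1-x_2u_j+x_4v_j\end{bmatrix};$$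 * $B_j$, $j>t$: $a\mapsto\left[\begin{smallmatrix}\beta_j&0\\0&\beta_j^{-1}\end{smallmatrix}\right]$, $b\mapsto\left[\begin{smallmatrix}0&-1\\1&0\end{smallmatrix}\right]$. **The dual.** Let $\mathcal C\subseteq\mathbb F_q^{4n}$ be a $Q_n$-code, i.e. a linear code such that, for a bijection $\phi:\{1,\dots,4n\}\to Q_n$, the set $I_{\mathcal C}=\{\sum_i c_i\phi(i)\mid c\in\mathcal C\}$ is a left ideal of $\mathbb F_q[Q_n]$. Let $\mathcal C^{\perp_E}=\{y\mid\sum_i x_iy_i=0\ \forall x\in\mathcal C\}$, and let $I_{\mathcal C^{\perp_E}}$ be formed with the same $\phi$. Writing $\langle M\rangle$ for the left ideal generated by $M$, there are matrices in reduced row echelon form $M_i\in A_i$, $N_j\in B_j$ (elements of a field being $1\times1$ matrices) with $$\psi(I_{\mathcal C})=\bigoplus_{i=1}^{r+s}\langle M_i\rangle\oplus\bigoplus_{j=1}^{t+k}\langle N_j\rangle ,$$ and for all such $M_i,N_j$ one has $$\psi(I_{\mathcal C^{\perp_E}})=\bigoplus_{i=1}^{r+s}\langle\widetilde M_i\rangle\oplus\bigoplus_{j=1}^{t+k}\langle\widetilde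 N_j\rangle ,$$ where * $i=1$: $\langle\widetilde M_1\rangle=\mathbb F_q\oplus\mathbb F_q,\ \mathbb F_q\oplus0,\ 0\oplus\mathbb F_q,\ 0\oplus0$ according as $\langle M_1\rangle=0\oplus0,\ 0\oplus\mathbb F_q,\ \mathbb F_q\oplus0,\ \mathbb F_q\oplus\mathbb F_q$; * $2\le i\le r$: $\widetilde M_i=\left[\begin{smallmatrix}1&0\\0&1\end{smallmatrix}\right],\ \left[\begin{smallmatrix}2&-\alpha_i-\alpha_i^{-1}\\0&0\end{smallmatrix}\right],\ \left[\begin{smallmatrix}\alpha_i+\alpha_i^{-1}+2\lambda&-2-(\alpha_i+\alpha_i^{-1})\lambda\\0&0\end{smallmatrix}\right],\ 0$ according as $M_i=0,\ \left[\begin{smallmatrix}0&1\\0&0\end{smallmatrix}\right],\ \left[\begin{smallmatrix}1&\lambda\\0&0\end{smallmatrix}\right],\ \left[\begin{smallmatrix}1&0\\0&1\end{smallmatrix}\right]$; * $r<i\le r+s$: $\widetilde M_i=\left[\begin{smallmatrix}1&0\\0&1\end{smallmatrix}\right],\ \left[\begin{smallmatrix}0&1\\0&0\end{smallmatrix}\right],\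 \left[\begin{smallmatrix}1&-\lambda\\0&0\end{smallmatrix}\right],\ 0$ according as $M_i=0,\ \left[\begin{smallmatrix}0&1\\0&0\end{smallmatrix}\right],\ \left[\begin{smallmatrix}1&\lambda\\0&0\end{smallmatrix}\right],\ \left[\begin{smallmatrix}1&0\\0&1\end{smallmatrix}\right]$; * every $1\le j\le t+k$: $\langle\widetilde N_j\rangle=B_j$ if $\langle N_j\rangle=0$, $\langle\widetilde N_j\rangle=0$ if $\langle N_j\rangle=B_j$, and $\langle\widetilde N_j\rangle=\langle N_j\rangle$ otherwise. -/

import Mathlib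

open Polynomial
open scoped IntermediateField

noncomputable section

namespace QuaternionCode

/-! ### Group codes and euclidean duality -/

/-- The euclidean dual of a linear code of length `m` over `F`. -/
def euclideanDual {F : Type*} [Field F] {m : ℕ} (C : Submodule F (Fin m → F)) :
    Submodule F (Fin m → F) where
  carrier := {y | ∀ x ∈ C, ∑ i, x i * y i = 0}
  zero_mem' := by
    intro x _
    simp
  add_mem' := by
    intro y z hy hz x hx
    simp only [Pi.add_apply, mul_add, Finset.sum_add_distrib, hy x hx, hz x hx, add_zero]
  smul_mem' := by
    intro c y hy x hx
    have h : ∑ i, x i * (c • y) i = c * ∑ i, x i * y i := by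
      rw [Finset.mul_sum]
      refine Finset.sum_congr rfl fun i _ => ?_
      simp only [Pi.smul_apply, smul_eq_mul]
      ring
    rw [h, hy x hx, mul_zero]

/-- The subset `{∑ i, c i • φ i | c ∈ C}` of the group algebra that corresponds to the linear
code `C` under the labelling `φ` of the coordinates by the elements of `G`. -/
def groupAlgebraSet {F G : Type*} [Field F] [Group G] {m : ℕ} (φ : Fin m ≃ G)
    (C : Submodule F (Fin m → F)) : Set (MonoidAlgebra F G) :=
  {x | ∃ c ∈ C, x = ∑ i, c i • MonoidAlgebra.of F G (φ i)}

/-- `C` is a (left) `G`-code via the labelling `φ`: the corresponding subset of the group algebra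
is a left ideal (`Ideal` means left ideal for a noncommutative ring). -/
def IsGroupCodeVia {F G : Type*} [Field F] [Group G] {m : ℕ} (φ : Fin m ≃ G)
    (C : Submodule F (Fin m → F)) : Prop :=
  ∃ I : Ideal (MonoidAlgebra F G), (I : Set (MonoidAlgebra F G)) = groupAlgebraSet φ C

/-! ### Factorisation into self-reciprocal factors and reciprocal pairs -/

/-- The reciprocal polynomial `g^*(x) = g(0)⁻¹ x^(deg g) g(x⁻¹)`. -/
def reciprocal {F : Type*} [Field F] (g : F[X]) : F[X] :=
  C (g.eval 0)⁻¹ * g.reverse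

/-- A factorisation of `P` into monic irreducible polynomials of the form
`P = ℓ * ∏ selfFactor i * ∏ (pairFactor i * (pairFactor i)^*)`, where `ℓ` is the distinguished
(linear) first factor and the `selfFactor i` are the *other* self-reciprocal factors, together with
the choice of a root in `K` of each `selfFactor i` and of each `pairFactor i`. -/
structure RecipFactorization (F K : Type*) [Field F] [Field K] [Algebra F K] (ℓ P : F[X]) where
  numSelf : ℕ
  numPair : ℕ
  selfFactor : Fin numSelf → F[X]
  pairFactor : Fin numPair → F[X]
  selfFactor_monic : ∀ i, (selfFactor i).Monic
  selfFactor_irreducible : ∀ i, Irreducible (selfFactor i)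
  selfFactor_reciprocal : ∀ i, reciprocal (selfFactor i) = selfFactor i
  pairFactor_monic : ∀ i, (pairFactor i).Monic
  pairFactor_irreducible : ∀ i, Irreducible (pairFactor i)
  prod_eq : P = ℓ * (∏ i, selfFactor i) * ∏ i, (pairFactor i * reciprocal (pairFactor i))
  selfRoot : Fin numSelf → K
  pairRoot : Fin numPair → K
  selfRoot_isRoot : ∀ i, aeval (selfRoot i) (selfFactor i) = 0
  pairRoot_isRoot : ∀ i, aeval (pairRoot i) (pairFactor i) = 0

/-- `2 × 2` matrices over a field. -/
abbrev Mat2 (E : Type*) : Type _ := Matrix (Fin 2) (Fin 2) E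

section Decomposition

variable {F K : Type*} [Field F] [Field K] [Algebra F K]

/-- The field `F(α + α⁻¹)` for the chosen root `α` of a self-reciprocal factor. -/
abbrev RecipFactorization.SelfField {ℓ P : F[X]} (fx : RecipFactorization F K ℓ P)
    (i : Fin fx.numSelf) : IntermediateField F K :=
  F⟮fx.selfRoot i + (fx.selfRoot i)⁻¹⟯

/-- The field `F(α)` for the chosen root `α` of a factor that belongs to a reciprocal pair. -/
abbrev RecipFactorization.PairField {ℓ P : F[X]} (fx : RecipFactorization F K ℓ P)
    (i : Fin fx.numPair) : IntermediateField F K :=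
  F⟮fx.pairRoot i⟯

/-- The sum of all the components `A_i`. -/
abbrev DihedralPart {ℓ P : F[X]} (fx : RecipFactorization F K ℓ P) : Type _ :=
  (F × F) × ((i : Fin fx.numSelf) → Mat2 (fx.SelfField i)) ×
    ((i : Fin fx.numPair) → Mat2 (fx.PairField i))

/-- The sum of all the components `B_j`; here `ι` is the chosen square root of `-1`. -/
abbrev QuaternionPart {ℓ P : F[X]} (gx : RecipFactorization F K ℓ P) (ι : K) : Type _ :=
  F⟮ι⟯ × ((j : Fin gx.numSelf) → Mat2 (gx.SelfField j)) ×
    ((j : Fin gx.numPair) → Mat2 (gx.PairField j))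

/-- The sum of all the components `A_i` and `B_j`. -/
abbrev Decomp {ℓ P ℓ' P' : F[X]} (fx : RecipFactorization F K ℓ P)
    (gx : RecipFactorization F K ℓ' P') (ι : K) : Type _ :=
  DihedralPart fx × QuaternionPart gx ι

/-! ### The explicit isomorphism -/

/-- The conjugation `X ↦ Z⁻¹ X Z` with `Z = [1, -α; 1, -α⁻¹]`. -/
def sigmaMap (α : K) (X : Mat2 K) : Mat2 K :=
  (!![1, -α; 1, -α⁻¹] : Mat2 K)⁻¹ * X * !![1, -α; 1, -α⁻¹]

/-- The conjugation `X ↦ Z⁻¹ X Z` with `Z = [ι, -β; ι, -β⁻¹]`. -/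
def gammaMap (ι β : K) (X : Mat2 K) : Mat2 K :=
  (!![ι, -β; ι, -β⁻¹] : Mat2 K)⁻¹ * X * !![ι, -β; ι, -β⁻¹]

/-- The map
`[x₁ + x₂ ι, x₃ + x₄ ι; -(x₃ - x₄ ι), x₁ - x₂ ι] ↦
  [x₁ + x₂ u - x₄ v, x₃ + x₂ v + x₄ u; -x₃ + x₂ v + x₄ u, x₁ - x₂ u + x₄ v]`;
the coordinates `x₁, …, x₄` are recovered from the entries of the matrix, see `thetaMap_apply`. -/
def thetaMap (ι u v : K) (X : Mat2 K) : Mat2 K :=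
  let x₁ := (X 0 0 + X 1 1) / 2
  let x₂ := (X 0 0 - X 1 1) / (2 * ι)
  let x₃ := (X 0 1 - X 1 0) / 2
  let x₄ := (X 0 1 + X 1 0) / (2 * ι)
  !![x₁ + x₂ * u - x₄ * v, x₃ + x₂ * v + x₄ * u;
     -x₃ + x₂ * v + x₄ * u, x₁ - x₂ * u + x₄ * v]

theorem thetaMap_apply (ι u v x₁ x₂ x₃ x₄ : K) (h2 : (2 : K) ≠ 0) (hι : ι ≠ 0) :
    thetaMap ι u v
        !![x₁ + x₂ * ι, x₃ + x₄ * ι; -(x₃ - x₄ * ι), x₁ - x₂ * ι] =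
      !![x₁ + x₂ * u - x₄ * v, x₃ + x₂ * v + x₄ * u;
        -x₃ + x₂ * v + x₄ * u, x₁ - x₂ * u + x₄ * v] := by
  have e1 : (x₁ + x₂ * ι + (x₁ - x₂ * ι)) / 2 = x₁ := by field_simp; ring
  have e2 : (x₁ + x₂ * ι - (x₁ - x₂ * ι)) / (2 * ι) = x₂ := by field_simp; ring
  have e3 : (x₃ + x₄ * ι - -(x₃ - x₄ * ι)) / 2 = x₃ := by field_simp; ring
  have e4 : (x₃ + x₄ * ι + -(x₃ - x₄ * ι)) / (2 * ι) = x₄ := by field_simp; ring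
  simp only [thetaMap, Matrix.of_apply, Matrix.cons_val', Matrix.cons_val_zero,
    Matrix.cons_val_one, Matrix.cons_val_fin_one, e1, e2, e3, e4]

/-- A matrix over a subfield of `K`, read as a matrix over `K`. -/
abbrev toK {E : IntermediateField F K} (X : Mat2 E) : Mat2 K :=
  X.map (algebraMap E K)

/-- The values that `ψ` is prescribed to take on the generators `a` and `b` of
`Q_n = ⟨a, b | a^(2n) = 1, b² = a^n, b⁻¹ a b = a⁻¹⟩`, component by component. Here `a` and `b` are
the elements `QuaternionGroup.a 1` and `QuaternionGroup.xa 0`. -/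
structure IsStandardIso {n : ℕ} {ℓ P ℓ' P' : F[X]} (fx : RecipFactorization F K ℓ P)
    (gx : RecipFactorization F K ℓ' P') (ι : K)
    (u v : (j : Fin gx.numSelf) → gx.SelfField j)
    (ψ : MonoidAlgebra F (QuaternionGroup n) ≃ₐ[F] Decomp fx gx ι) : Prop where
  first_a : (ψ (MonoidAlgebra.of F _ (QuaternionGroup.a 1))).1.1 = (1, 1)
  first_b : (ψ (MonoidAlgebra.of F _ (QuaternionGroup.xa 0))).1.1 = (1, -1)
  dihSelf_a : ∀ i, toK ((ψ (MonoidAlgebra.of F _ (QuaternionGroup.a 1))).1.2.1 i) =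
    sigmaMap (fx.selfRoot i) !![fx.selfRoot i, 0; 0, (fx.selfRoot i)⁻¹]
  dihSelf_b : ∀ i, toK ((ψ (MonoidAlgebra.of F _ (QuaternionGroup.xa 0))).1.2.1 i) =
    sigmaMap (fx.selfRoot i) !![0, 1; 1, 0]
  dihPair_a : ∀ i, toK ((ψ (MonoidAlgebra.of F _ (QuaternionGroup.a 1))).1.2.2 i) =
    !![fx.pairRoot i, 0; 0, (fx.pairRoot i)⁻¹]
  dihPair_b : ∀ i, toK ((ψ (MonoidAlgebra.of F _ (QuaternionGroup.xa 0))).1.2.2 i) =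
    !![0, 1; 1, 0]
  second_a : (ψ (MonoidAlgebra.of F _ (QuaternionGroup.a 1))).2.1 = -1
  second_b : (((ψ (MonoidAlgebra.of F _ (QuaternionGroup.xa 0))).2.1 : F⟮ι⟯) : K) = ι
  gamma_a : ∀ j, 4 ∣ (gx.selfFactor j).natDegree →
    toK ((ψ (MonoidAlgebra.of F _ (QuaternionGroup.a 1))).2.2.1 j) =
      gammaMap ι (gx.selfRoot j) !![gx.selfRoot j, 0; 0, (gx.selfRoot j)⁻¹]
  gamma_b : ∀ j, 4 ∣ (gx.selfFactor j).natDegree →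
    toK ((ψ (MonoidAlgebra.of F _ (QuaternionGroup.xa 0))).2.2.1 j) =
      gammaMap ι (gx.selfRoot j) !![0, ι; ι, 0]
  theta_a : ∀ j, ¬ 4 ∣ (gx.selfFactor j).natDegree →
    toK ((ψ (MonoidAlgebra.of F _ (QuaternionGroup.a 1))).2.2.1 j) =
      thetaMap ι (u j) (v j) !![gx.selfRoot j, 0; 0, (gx.selfRoot j)⁻¹]
  theta_b : ∀ j, ¬ 4 ∣ (gx.selfFactor j).natDegree →
    toK ((ψ (MonoidAlgebra.of F _ (QuaternionGroup.xa 0))).2.2.1 j) =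
      thetaMap ι (u j) (v j) !![0, ι; ι, 0]
  quatPair_a : ∀ j, toK ((ψ (MonoidAlgebra.of F _ (QuaternionGroup.a 1))).2.2.2 j) =
    !![gx.pairRoot j, 0; 0, (gx.pairRoot j)⁻¹]
  quatPair_b : ∀ j, toK ((ψ (MonoidAlgebra.of F _ (QuaternionGroup.xa 0))).2.2.2 j) =
    !![0, -1; 1, 0]

/-! ### Left ideals of the decomposition and the duality rule -/

/-- All components of the tuple `m = (M_i, N_j)` are in reduced row echelon form; an element of a
field is read as a `1 × 1` matrix. -/
structure IsReducedTuple {ℓ P ℓ' P' : F[X]} {fx : RecipFactorization F K ℓ P}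
    {gx : RecipFactorization F K ℓ' P'} {ι : K} (m : Decomp fx gx ι) : Prop where
  first_fst : (!![m.1.1.1] : Matrix (Fin 1) (Fin 1) F).IsReducedRowEchelon
  first_snd : (!![m.1.1.2] : Matrix (Fin 1) (Fin 1) F).IsReducedRowEchelon
  dihSelf : ∀ i, (m.1.2.1 i).IsReducedRowEchelon
  dihPair : ∀ i, (m.1.2.2 i).IsReducedRowEchelon
  second : (!![m.2.1] : Matrix (Fin 1) (Fin 1) F⟮ι⟯).IsReducedRowEchelon
  quatSelf : ∀ j, (m.2.2.1 j).IsReducedRowEchelon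
  quatPair : ∀ j, (m.2.2.2 j).IsReducedRowEchelon

/-- The left ideal `⨁ ⟨M_i⟩ ⊕ ⨁ ⟨N_j⟩` for the tuple `m = (M_i, N_j)`. -/
def tupleIdeal {ℓ P ℓ' P' : F[X]} {fx : RecipFactorization F K ℓ P}
    {gx : RecipFactorization F K ℓ' P'} {ι : K} (m : Decomp fx gx ι) : Ideal (Decomp fx gx ι) :=
  Ideal.prod
    (Ideal.prod (Ideal.span {m.1.1})
      (Ideal.prod (Ideal.pi fun i => Ideal.span {m.1.2.1 i})
        (Ideal.pi fun i => Ideal.span {m.1.2.2 i})))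
    (Ideal.prod (Ideal.span {m.2.1})
      (Ideal.prod (Ideal.pi fun j => Ideal.span {m.2.2.1 j})
        (Ideal.pi fun j => Ideal.span {m.2.2.2 j})))

open Classical in
/-- The rule on the component `F ⊕ F`, whose only ideals are `0 ⊕ 0`, `0 ⊕ F`, `F ⊕ 0`, `F ⊕ F`. -/
def dualFirst (I : Ideal (F × F)) : Ideal (F × F) :=
  if I = Ideal.prod ⊥ ⊥ then Ideal.prod ⊤ ⊤
  else if I = Ideal.prod ⊥ ⊤ then Ideal.prod ⊤ ⊥
  else if I = Ideal.prod ⊤ ⊥ then Ideal.prod ⊥ ⊤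
  else Ideal.prod ⊥ ⊥

open Classical in
/-- The rule `M ↦ M̃` on a component `M₂(F(α + α⁻¹))`, where `s = α + α⁻¹`. A matrix in reduced row
echelon form to which none of the first three cases applies is `[1, l; 0, 0]` with `l = M 0 1`. -/
def dualDihSelf {E : Type*} [Field E] (s : E) (M : Mat2 E) : Mat2 E :=
  if M = 0 then 1
  else if M = !![0, 1; 0, 0] then !![2, -s; 0, 0]
  else if M = 1 then 0
  else !![s + 2 * M 0 1, -2 - s * M 0 1; 0, 0]

open Classical in
/-- The rule `M ↦ M̃` on a component `M₂(F(α))` that belongs to a reciprocal pair. A matrix in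
reduced row echelon form to which none of the first three cases applies is `[1, l; 0, 0]` with
`l = M 0 1`. -/
def dualDihPair {E : Type*} [Field E] (M : Mat2 E) : Mat2 E :=
  if M = 0 then 1
  else if M = !![0, 1; 0, 0] then !![0, 1; 0, 0]
  else if M = 1 then 0
  else !![1, -M 0 1; 0, 0]

open Classical in
/-- The rule on a component `B_j`: `0` and `B_j` are interchanged, and every other left ideal is
kept. -/
def dualQuat {B : Type*} [Ring B] (I : Ideal B) : Ideal B :=
  if I = ⊥ then ⊤ else if I = ⊤ then ⊥ else I

/-- The left ideal `⨁ ⟨M̃_i⟩ ⊕ ⨁ ⟨Ñ_j⟩` for the tuple `m = (M_i, N_j)`. -/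
def dualTupleIdeal {ℓ P ℓ' P' : F[X]} {fx : RecipFactorization F K ℓ P}
    {gx : RecipFactorization F K ℓ' P'} {ι : K} (m : Decomp fx gx ι) : Ideal (Decomp fx gx ι) :=
  Ideal.prod
    (Ideal.prod (dualFirst (Ideal.span {m.1.1}))
      (Ideal.prod
        (Ideal.pi fun i => Ideal.span
          {dualDihSelf (IntermediateField.AdjoinSimple.gen F
            (fx.selfRoot i + (fx.selfRoot i)⁻¹)) (m.1.2.1 i)})
        (Ideal.pi fun i => Ideal.span {dualDihPair (m.1.2.2 i)})))
    (Ideal.prod (dualQuat (Ideal.span {m.2.1}))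
      (Ideal.prod (Ideal.pi fun j => dualQuat (Ideal.span {m.2.2.1 j}))
        (Ideal.pi fun j => dualQuat (Ideal.span {m.2.2.2 j}))))

end Decomposition

end QuaternionCode

end

/-! The isomorphism. Over `K` every matrix component is conjugate to a ↦ diag(β, β⁻¹), b ↦ [0, c; d,
0] with cd = βⁿ = ±1 (`IsSplitPair`); this alone gives the relations of Q_n. The maps σ, γ and θ
only move this pair into matrices over E = F(β + β⁻¹). For a self-reciprocal factor β has degree 2
over E, so the degree of the factor is 2[E : F] (`natDegree_eq_two_mul_finrank`). As q ≡ 3 mod 4, ι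
lies in E exactly when 4 divides that degree: then γ has entries in E. Otherwise s² - 4 (with s = β
+ β⁻¹) and -1 are both nonsquares of E, so (β - β⁻¹)/(2ι) lies in E and θ has entries there
(`sub_inv_div_mem`).

Injectivity (`IsSplitHom.injective`): every element of F[Q_n] is P(a) + b R(a). In a split pair P(a)
is diagonal and b R(a) antidiagonal, so an element of the kernel has P and R vanishing at all roots
of xⁿ - 1 and xⁿ + 1. These polynomials are squarefree and coprime, so x²ⁿ - 1 divides P and R, and
P(a) = R(a) = 0. The target has dimension at most 4n, which gives bijectivity.

The dual. Write x̂ for the image of x under g ↦ g⁻¹. The euclidean product of x and y is the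
coefficient of 1 in y x̂, so the dual of a left ideal I is the set of y with y x̂ = 0 for all x in
I, and one generator of I suffices (`mem_image_euclideanDual_iff`). In a matrix component the
generators preserve a nondegenerate bilinear form S, hence S χ(x̂) = χ(x)ᵀ S
(`mul_map_invMap_eq_transpose_mul`): inversion becomes the adjoint, and the dual of ⟨M⟩ consists of
the matrices whose rows are orthogonal to those of M under S⁻¹. On the B_j the form is alternating,
so a line is its own orthogonal and ideals of rank one are kept. On the A_i the form is symmetric,
which yields the explicit generators M̃. -/

noncomputable section

namespace QuaternionCode

/-! ### Left ideals of 2 × 2 matrices and their orthogonals. -/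

section Matrices

variable {E : Type*} [Field E]

theorem isReducedRowEchelon_zero : (0 : Mat2 E).IsReducedRowEchelon where
  isRowEchelon := fun _ _ _ _ _ => rfl
  eq_one := fun _ _ h => absurd rfl h.2
  eq_zero := fun _ _ _ _ _ => rfl

theorem isReducedRowEchelon_one : (1 : Mat2 E).IsReducedRowEchelon where
  isRowEchelon := by
    intro i j hij k hk
    by_cases hjk : j = k
    · subst hjk
      exact absurd (hk i hij) (by simp)
    · exact Matrix.one_apply_ne hjk
  eq_one := by
    intro i j h
    have := h.2
    by_cases hij : i = j
    · rw [hij, Matrix.one_apply_eq]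
    · exact absurd (Matrix.one_apply_ne hij) this
  eq_zero := by
    intro i j k hij h
    have := h.2
    by_cases hjk : j = k
    · rw [← hjk, Matrix.one_apply_ne hij.ne]
    · exact absurd (Matrix.one_apply_ne hjk) this

theorem isReducedRowEchelon_row (p q : E) (h : p = 1 ∨ (p = 0 ∧ q = 1)) :
    (!![p, q; 0, 0] : Mat2 E).IsReducedRowEchelon where
  isRowEchelon := by
    intro i j hij k hk
    fin_cases i <;> fin_cases j <;> fin_cases k <;> simp_all
  eq_one := by
    intro i j hj
    have h2 := hj.2
    fin_cases i <;> fin_cases j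
    · simp at h2 ⊢
      tauto
    · have h1 := hj.1 0 (by simp)
      simp at h1 h2 ⊢
      subst h1
      simpa using h
    · simp at h2
    · simp at h2
  eq_zero := by
    intro i j k hij hj
    have h2 := hj.2
    fin_cases i <;> fin_cases j <;> fin_cases k <;> simp at hij h2

theorem eq_of_isReducedRowEchelon {M : Mat2 E} (h : M.IsReducedRowEchelon) :
    M = 0 ∨ M = 1 ∨ M = !![0, 1; 0, 0] ∨ ∃ l, M = !![1, l; 0, 0] := by
  have h10 : M 1 0 = 0 := h.isRowEchelon (i₁ := 0) (i₂ := 1) (by simp) (by simp)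
  by_cases h00 : M 0 0 = 0
  · have h11 : M 1 1 = 0 := h.isRowEchelon (i₁ := 0) (i₂ := 1) (by simp) (by
      intro j hj
      fin_cases j
      · exact h00
      · simp at hj)
    by_cases h01 : M 0 1 = 0
    · left
      ext i j
      fin_cases i <;> fin_cases j <;> simpa
    · have : M 0 1 = 1 := h.eq_one ⟨fun j hj => by
        fin_cases j
        · exact h00
        · simp at hj, h01⟩
      right; right; left
      ext i j
      fin_cases i <;> fin_cases j <;> simpa
  · have e00 : M 0 0 = 1 := h.eq_one ⟨by simp, h00⟩
    by_cases h11 : M 1 1 = 0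
    · right; right; right
      refine ⟨M 0 1, ?_⟩
      ext i j
      fin_cases i <;> fin_cases j <;> first | rfl | simpa
    · have hl : M.IsLeadingEntry 1 1 := ⟨fun j hj => by
        fin_cases j
        · exact h10
        · simp at hj, h11⟩
      have e11 := h.eq_one hl
      have e01 : M 0 1 = 0 := h.eq_zero (i₁ := 0) (by simp) hl
      right; left
      ext i j
      fin_cases i <;> fin_cases j <;> simpa

/-- Left multiples of this matrix have both rows proportional to (p, q), and proportionality to a
nonzero row is the vanishing of a 2 × 2 minor. -/
theorem mem_span_row {p q : E} (h : p ≠ 0 ∨ q ≠ 0) (y : Mat2 E) :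
    y ∈ Ideal.span {(!![p, q; 0, 0] : Mat2 E)} ↔
      y 0 0 * q = y 0 1 * p ∧ y 1 0 * q = y 1 1 * p := by
  rw [Ideal.mem_span_singleton']
  constructor
  · rintro ⟨z, rfl⟩
    simp [Matrix.mul_apply, Fin.sum_univ_two]
    constructor <;> ring
  · rintro ⟨h0, h1⟩
    rcases h with h | h
    · refine ⟨!![y 0 0 / p, 0; y 1 0 / p, 0], ?_⟩
      ext i j
      fin_cases i <;> fin_cases j <;> simp [Matrix.mul_apply, Fin.sum_univ_two] <;>
        field_simp
      · linear_combination h0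
      · linear_combination h1
    · refine ⟨!![y 0 1 / q, 0; y 1 1 / q, 0], ?_⟩
      ext i j
      fin_cases i <;> fin_cases j <;> simp [Matrix.mul_apply, Fin.sum_univ_two] <;>
        field_simp
      · linear_combination -h0
      · linear_combination -h1

theorem span_row_ne_bot {p q : E} (h : p ≠ 0 ∨ q ≠ 0) :
    Ideal.span {(!![p, q; 0, 0] : Mat2 E)} ≠ ⊥ := by
  intro hb
  rw [Ideal.span_singleton_eq_bot] at hb
  have h0 := congrFun (congrFun hb 0) 0
  have h1 := congrFun (congrFun hb 0) 1
  simp at h0 h1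
  tauto

theorem span_row_ne_top {p q : E} (h : p ≠ 0 ∨ q ≠ 0) :
    Ideal.span {(!![p, q; 0, 0] : Mat2 E)} ≠ ⊤ := by
  intro hb
  have := (mem_span_row h 1).1 (hb ▸ Submodule.mem_top)
  simp at this
  tauto

/-- Every left ideal of `M₂(E)` is generated by a matrix in reduced row echelon form. -/
theorem exists_isReducedRowEchelon_span (J : Ideal (Mat2 E)) :
    ∃ M : Mat2 E, M.IsReducedRowEchelon ∧ J = Ideal.span {M} := by
  by_cases hdet : ∃ y ∈ J, y.det ≠ 0
  · obtain ⟨y, hy, hd⟩ := hdet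
    refine ⟨1, isReducedRowEchelon_one, ?_⟩
    rw [Ideal.span_singleton_one, Ideal.eq_top_iff_one]
    have := J.mul_mem_left y⁻¹ hy
    rwa [Matrix.nonsing_inv_mul _ (isUnit_iff_ne_zero.2 hd)] at this
  push Not at hdet
  by_cases hJ : J = ⊥
  · exact ⟨0, isReducedRowEchelon_zero, by simp [hJ]⟩
  obtain ⟨y, hy, hy0⟩ := Submodule.exists_mem_ne_zero_of_ne_bot hJ
  -- Left multiplication by matrix units isolates a row, rescales it and moves it to either
  -- position.
  have hrow : ∀ x ∈ J, ∀ i, ∀ c : E, (!![c * x i 0, c * x i 1; 0, 0] : Mat2 E) ∈ J := by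
    intro x hx i c
    have := J.mul_mem_left (Matrix.single 0 i c) hx
    convert this using 1
    ext k l
    fin_cases k <;> fin_cases l <;> simp [Matrix.single_mul_apply_of_ne]
  have hrow' : ∀ x ∈ J, ∀ i, (!![0, 0; x i 0, x i 1] : Mat2 E) ∈ J := by
    intro x hx i
    have := J.mul_mem_left (Matrix.single 1 i 1) hx
    convert this using 1
    ext k l
    fin_cases k <;> fin_cases l <;> simp [Matrix.single_mul_apply_of_ne]
  obtain ⟨p, q, hpq, hmem⟩ : ∃ p q : E, (p = 1 ∨ (p = 0 ∧ q = 1)) ∧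
      (!![p, q; 0, 0] : Mat2 E) ∈ J := by
    obtain ⟨i, hi⟩ : ∃ i, y i 0 ≠ 0 ∨ y i 1 ≠ 0 := by
      by_contra! hcon
      refine hy0 ?_
      ext i j
      fin_cases j
      · exact (hcon i).1
      · exact (hcon i).2
    by_cases h0 : y i 0 = 0
    · have h1 : y i 1 ≠ 0 := by tauto
      refine ⟨0, 1, by simp, ?_⟩
      simpa [h0, h1] using hrow y hy i (y i 1)⁻¹
    · refine ⟨1, (y i 0)⁻¹ * y i 1, by simp, ?_⟩
      simpa [h0] using hrow y hy i (y i 0)⁻¹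
  refine ⟨_, isReducedRowEchelon_row p q hpq, le_antisymm ?_ ?_⟩
  · intro x hx
    have hne : p ≠ 0 ∨ q ≠ 0 := by
      rcases hpq with h | h <;> simp [h]
    rw [mem_span_row hne]
    -- The matrix with rows (p, q) and the i-th row of x lies in J, hence is singular: all rows
    -- occurring in J are proportional to (p, q).
    have key : ∀ i, x i 0 * q = x i 1 * p := by
      intro i
      have := hdet _ (J.add_mem hmem (hrow' x hx i))
      rw [Matrix.det_fin_two] at this
      simp at this
      linear_combination -this
    exact ⟨key 0, key 1⟩
  · rw [Ideal.span_singleton_le_iff_mem]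
    exact hmem

/-- The hypothesis makes N the adjugate of M, the adjoint for the alternating form. A row killed by
the adjugate of a rank one M is orthogonal to the row of M, hence proportional to it. -/
theorem mul_eq_zero_iff_mem_dualQuat {M N : Mat2 E} (hM : M.IsReducedRowEchelon)
    (h : !![0, 1; -1, 0] * N = M.transpose * !![0, 1; -1, 0]) (y : Mat2 E) :
    y * N = 0 ↔ y ∈ dualQuat (Ideal.span {M}) := by
  have hN : N = !![M 1 1, -M 0 1; -M 1 0, M 0 0] := by
    have e := fun i j => congrFun (congrFun h i) j
    simp only [Matrix.mul_apply, Fin.sum_univ_two, Matrix.transpose_apply] at e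
    ext i j
    fin_cases i <;> fin_cases j
    · simpa using e 1 0
    · simpa [neg_eq_iff_eq_neg] using e 1 1
    · simpa using e 0 0
    · simpa using e 0 1
  have row : ∀ p q : E, (p ≠ 0 ∨ q ≠ 0) → M = !![p, q; 0, 0] →
      (y * N = 0 ↔ y ∈ dualQuat (Ideal.span {M})) := by
    intro p q hpq hM'
    subst hM'
    rw [dualQuat, if_neg (span_row_ne_bot hpq), if_neg (span_row_ne_top hpq), mem_span_row hpq,
      hN, ← Matrix.ext_iff]
    simp [Matrix.mul_apply, Fin.sum_univ_two, Fin.forall_fin_two]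
    constructor <;> rintro ⟨h0, h1⟩ <;> constructor
    · linear_combination -h0
    · linear_combination -h1
    · linear_combination -h0
    · linear_combination -h1
  rcases eq_of_isReducedRowEchelon hM with rfl | rfl | hM | ⟨l, hM⟩
  · have : N = 0 := by rw [hN]; ext i j; fin_cases i <;> fin_cases j <;> simp
    simp [this, dualQuat]
  · have : N = 1 := by rw [hN]; ext i j; fin_cases i <;> fin_cases j <;> simp
    simp [this, dualQuat]
  · exact row _ _ (by simp) hM
  · exact row _ _ (by simp) hM

/-- Here N is the adjoint for the hyperbolic form x₀y₁ + x₁y₀, under which (1, -l) spans the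
orthogonal of (1, l) and (0, 1) is isotropic. -/
theorem mul_eq_zero_iff_mem_dualDihPair {M N : Mat2 E} (hM : M.IsReducedRowEchelon)
    (h : !![0, 1; 1, 0] * N = M.transpose * !![0, 1; 1, 0]) (y : Mat2 E) :
    y * N = 0 ↔ y ∈ Ideal.span {dualDihPair M} := by
  have hN : N = !![M 1 1, M 0 1; M 1 0, M 0 0] := by
    have e := fun i j => congrFun (congrFun h i) j
    simp only [Matrix.mul_apply, Fin.sum_univ_two, Matrix.transpose_apply] at e
    ext i j
    fin_cases i <;> fin_cases j
    · simpa using e 1 0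
    · simpa using e 1 1
    · simpa using e 0 0
    · simpa using e 0 1
  rcases eq_of_isReducedRowEchelon hM with rfl | rfl | rfl | ⟨l, rfl⟩
  · have : N = 0 := by rw [hN]; ext i j; fin_cases i <;> fin_cases j <;> simp
    simp [this, dualDihPair, Ideal.span_singleton_one]
  · have h1 : N = 1 := by rw [hN]; ext i j; fin_cases i <;> fin_cases j <;> simp
    have h2 : (1 : Mat2 E) ≠ !![0, 1; 0, 0] := fun h => by simpa using congrFun (congrFun h 0) 0
    simp [h1, dualDihPair, h2]
  · have h2 : (!![0, 1; 0, 0] : Mat2 E) ≠ 0 := fun h => by simpa using congrFun (congrFun h 0) 1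
    rw [dualDihPair, if_neg h2, if_pos rfl, mem_span_row (by simp), hN, ← Matrix.ext_iff]
    simp [Matrix.mul_apply, Fin.sum_univ_two, Fin.forall_fin_two]
  · have h2 : (!![1, l; 0, 0] : Mat2 E) ≠ 0 := fun h => by simpa using congrFun (congrFun h 0) 0
    have h3 : (!![1, l; 0, 0] : Mat2 E) ≠ !![0, 1; 0, 0] :=
      fun h => by simpa using congrFun (congrFun h 0) 0
    have h4 : (!![1, l; 0, 0] : Mat2 E) ≠ 1 := fun h => by simpa using congrFun (congrFun h 1) 1
    rw [dualDihPair, if_neg h2, if_neg h3, if_neg h4, mem_span_row (by simp), hN,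
      ← Matrix.ext_iff]
    simp [Matrix.mul_apply, Fin.sum_univ_two, Fin.forall_fin_two]
    constructor <;> rintro ⟨h0, h1⟩ <;> constructor
    · linear_combination -h0
    · linear_combination -h1
    · linear_combination -h0
    · linear_combination -h1

theorem mul_eq_zero_iff_mem_dualDihSelf {s : E} (h2 : (2 : E) ≠ 0) (hs : 4 - s ^ 2 ≠ 0)
    {M N : Mat2 E} (hM : M.IsReducedRowEchelon)
    (h : !![2, -s; -s, 2] * N = M.transpose * !![2, -s; -s, 2]) (y : Mat2 E) :
    y * N = 0 ↔ y ∈ Ideal.span {dualDihSelf s M} := by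
  have hadj : (!![2, s; s, 2] * !![2, -s; -s, 2] : Mat2 E) = (4 - s ^ 2) • 1 := by
    ext i j
    fin_cases i <;> fin_cases j <;> simp [Matrix.mul_apply, Fin.sum_univ_two] <;> ring
  have hadj' : (!![2, -s; -s, 2] * !![2, s; s, 2] : Mat2 E) = (4 - s ^ 2) • 1 := by
    ext i j
    fin_cases i <;> fin_cases j <;> simp [Matrix.mul_apply, Fin.sum_univ_two] <;> ring
  -- N = S⁻¹ Mᵀ S for S = [2, -s; -s, 2]. Replacing S⁻¹ by the adjugate [2, s; s, 2] costs only the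
  -- nonzero scalar det S = 4 - s².
  have hN : y * N = 0 ↔ y * !![2, s; s, 2] * M.transpose = 0 := by
    have e1 : (4 - s ^ 2) • (y * N) = y * !![2, s; s, 2] * M.transpose * !![2, -s; -s, 2] := by
      rw [Matrix.mul_assoc _ M.transpose, ← h, Matrix.mul_assoc, ← Matrix.mul_assoc _ _ N, hadj]
      simp
    have e2 : (4 - s ^ 2) • (y * !![2, s; s, 2] * M.transpose) =
        ((4 - s ^ 2) • (y * N)) * !![2, s; s, 2] := by
      rw [e1, Matrix.mul_assoc _ !![2, -s; -s, 2], hadj']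
      simp
    constructor
    · intro h0
      rw [h0] at e2
      simpa [hs] using e2
    · intro h0
      rw [h0] at e1
      simpa [hs] using e1
  rw [hN]
  rcases eq_of_isReducedRowEchelon hM with rfl | rfl | rfl | ⟨l, rfl⟩
  · simp [dualDihSelf, Ideal.span_singleton_one]
  · have h3 : (1 : Mat2 E) ≠ !![0, 1; 0, 0] := fun h => by simpa using congrFun (congrFun h 0) 0
    simp only [dualDihSelf, one_ne_zero, h3, if_false, if_true, Matrix.transpose_one, mul_one,
      Ideal.span_singleton_zero, Ideal.mem_bot]
    constructor
    · intro h0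
      have : y * !![2, s; s, 2] * !![2, -s; -s, 2] = 0 := by rw [h0, zero_mul]
      rw [Matrix.mul_assoc, hadj] at this
      simpa [hs] using this
    · rintro rfl
      simp
  · have h3 : (!![0, 1; 0, 0] : Mat2 E) ≠ 0 := fun h => by simpa using congrFun (congrFun h 0) 1
    rw [dualDihSelf, if_neg h3, if_pos rfl, mem_span_row (by simp [h2]), ← Matrix.ext_iff]
    simp [Matrix.mul_apply, Fin.sum_univ_two, Fin.forall_fin_two]
    constructor <;> rintro ⟨h0, h1⟩ <;> constructor
    · linear_combination -h0
    · linear_combination -h1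
    · linear_combination -h0
    · linear_combination -h1
  · have h4 : (!![1, l; 0, 0] : Mat2 E) ≠ 0 := fun h => by simpa using congrFun (congrFun h 0) 0
    have h5 : (!![1, l; 0, 0] : Mat2 E) ≠ !![0, 1; 0, 0] :=
      fun h => by simpa using congrFun (congrFun h 0) 0
    have h6 : (!![1, l; 0, 0] : Mat2 E) ≠ 1 := fun h => by simpa using congrFun (congrFun h 1) 1
    have hne : s + 2 * (!![1, l; 0, 0] : Mat2 E) 0 1 ≠ 0 ∨
        -2 - s * (!![1, l; 0, 0] : Mat2 E) 0 1 ≠ 0 := by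
      by_contra! hcon
      simp at hcon
      refine hs ?_
      linear_combination -s * hcon.1 - 2 * hcon.2
    rw [dualDihSelf, if_neg h4, if_neg h5, if_neg h6, mem_span_row hne, ← Matrix.ext_iff]
    simp [Matrix.mul_apply, Fin.sum_univ_two, Fin.forall_fin_two]
    constructor <;> rintro ⟨h0, h1⟩ <;> constructor
    · linear_combination -h0
    · linear_combination -h1
    · linear_combination -h0
    · linear_combination -h1

end Matrices

/-! ### Explicit values of σ, γ and θ on the generators. -/

section Conjugation

variable {K : Type*} [Field K]

/-- An intertwining identity XZ = ZY spares the computation of Z⁻¹. -/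
theorem sigmaMap_eq {α : K} (h1 : α ≠ α⁻¹) (X Y : Mat2 K)
    (h : X * !![1, -α; 1, -α⁻¹] = !![1, -α; 1, -α⁻¹] * Y) : sigmaMap α X = Y := by
  have hd : IsUnit (!![1, -α; 1, -α⁻¹] : Mat2 K).det := by
    rw [Matrix.det_fin_two_of, isUnit_iff_ne_zero]
    intro h
    exact h1 (by linear_combination h)
  rw [sigmaMap, Matrix.mul_assoc, h, ← Matrix.mul_assoc, Matrix.nonsing_inv_mul _ hd, one_mul]

/-- The result is a companion matrix of X² - (α + α⁻¹)X + 1, so its entries lie in F(α + α⁻¹). -/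
theorem sigmaMap_diag {α : K} (h0 : α ≠ 0) (h1 : α ≠ α⁻¹) :
    sigmaMap α !![α, 0; 0, α⁻¹] = !![0, 1; -1, α + α⁻¹] := by
  refine sigmaMap_eq h1 _ _ ?_
  ext i j
  fin_cases i <;> fin_cases j <;> simp [Matrix.mul_apply, Fin.sum_univ_two] <;> field_simp <;> ring

theorem sigmaMap_swap {α : K} (h1 : α ≠ α⁻¹) :
    sigmaMap α !![0, 1; 1, 0] = !![1, -(α + α⁻¹); 0, -1] := by
  refine sigmaMap_eq h1 _ _ ?_
  ext i j
  fin_cases i <;> fin_cases j <;> simp [Matrix.mul_apply, Fin.sum_univ_two]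

theorem gammaMap_eq {ι β : K} (hι : ι ≠ 0) (h1 : β ≠ β⁻¹) (X Y : Mat2 K)
    (h : X * !![ι, -β; ι, -β⁻¹] = !![ι, -β; ι, -β⁻¹] * Y) : gammaMap ι β X = Y := by
  have hd : IsUnit (!![ι, -β; ι, -β⁻¹] : Mat2 K).det := by
    rw [Matrix.det_fin_two_of, isUnit_iff_ne_zero]
    intro h
    exact h1 (mul_left_cancel₀ hι (by linear_combination h))
  rw [gammaMap, Matrix.mul_assoc, h, ← Matrix.mul_assoc, Matrix.nonsing_inv_mul _ hd, one_mul]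

theorem gammaMap_diag {ι β : K} (hι : ι ^ 2 = -1) (h0 : β ≠ 0) (h1 : β ≠ β⁻¹) :
    gammaMap ι β !![β, 0; 0, β⁻¹] = !![0, -ι; -ι, β + β⁻¹] := by
  refine gammaMap_eq (by rintro rfl; simp at hι) h1 _ _ ?_
  ext i j
  fin_cases i <;> fin_cases j <;> simp [Matrix.mul_apply, Fin.sum_univ_two] <;> field_simp
  · linear_combination hι
  · linear_combination β ^ 2 * hι

theorem gammaMap_swap {ι β : K} (hι : ι ^ 2 = -1) (h1 : β ≠ β⁻¹) :
    gammaMap ι β !![0, ι; ι, 0] = !![ι, -(β + β⁻¹); 0, -ι] := by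
  refine gammaMap_eq (by rintro rfl; simp at hι) h1 _ _ ?_
  ext i j
  fin_cases i <;> fin_cases j <;> simp [Matrix.mul_apply, Fin.sum_univ_two] <;> ring

theorem thetaMap_diag {ι β : K} (u v : K) :
    thetaMap ι u v !![β, 0; 0, β⁻¹] =
      !![(β + β⁻¹) / 2 + (β - β⁻¹) / (2 * ι) * u, (β - β⁻¹) / (2 * ι) * v;
        (β - β⁻¹) / (2 * ι) * v, (β + β⁻¹) / 2 - (β - β⁻¹) / (2 * ι) * u] := by
  simp [thetaMap]

theorem thetaMap_swap {ι : K} (h2 : (2 : K) ≠ 0) (hι : ι ≠ 0) (u v : K) :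
    thetaMap ι u v !![0, ι; ι, 0] = !![-v, u; u, v] := by
  have h : (ι + ι) / (2 * ι) = 1 := by field_simp; ring
  simp [thetaMap, h]

end Conjugation

/-! ### Pairs of matrices conjugate over `K` to the standard ones. -/

section SplitPair

variable {K : Type*} [Field K]

/-- Over `K`, the pair `(A, B)` is simultaneously conjugate to
`([β, 0; 0, β⁻¹], [0, c; d, 0])`. -/
def IsSplitPair (β c d : K) (A B : Mat2 K) : Prop :=
  ∃ T : Mat2 K, IsUnit T ∧ T * A = !![β, 0; 0, β⁻¹] * T ∧ T * B = !![0, c; d, 0] * T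

theorem isSplitPair_self (β c d : K) : IsSplitPair β c d !![β, 0; 0, β⁻¹] !![0, c; d, 0] :=
  ⟨1, isUnit_one, by simp, by simp⟩

theorem isSplitPair_sigmaMap {α : K} (h1 : α ≠ α⁻¹) :
    IsSplitPair α 1 1 (sigmaMap α !![α, 0; 0, α⁻¹]) (sigmaMap α !![0, 1; 1, 0]) := by
  have hd : IsUnit (!![1, -α; 1, -α⁻¹] : Mat2 K).det := by
    rw [Matrix.det_fin_two_of, isUnit_iff_ne_zero]
    intro h
    exact h1 (by linear_combination h)
  refine ⟨!![1, -α; 1, -α⁻¹], (Matrix.isUnit_iff_isUnit_det _).2 hd, ?_, ?_⟩ <;>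
  simp only [sigmaMap, ← Matrix.mul_assoc, Matrix.mul_nonsing_inv _ hd, one_mul]

theorem isSplitPair_gammaMap {ι β : K} (hι : ι ≠ 0) (h1 : β ≠ β⁻¹) :
    IsSplitPair β ι ι (gammaMap ι β !![β, 0; 0, β⁻¹]) (gammaMap ι β !![0, ι; ι, 0]) := by
  have hd : IsUnit (!![ι, -β; ι, -β⁻¹] : Mat2 K).det := by
    rw [Matrix.det_fin_two_of, isUnit_iff_ne_zero]
    intro h
    exact h1 (mul_left_cancel₀ hι (by linear_combination h))
  refine ⟨!![ι, -β; ι, -β⁻¹], (Matrix.isUnit_iff_isUnit_det _).2 hd, ?_, ?_⟩ <;>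
  simp only [gammaMap, ← Matrix.mul_assoc, Matrix.mul_nonsing_inv _ hd, one_mul]

/-- θ is conjugation by T = [u + ι, v; -v, u + ι]. As u² + v² = ι², the determinant of T is 2ι(u +
ι), so `hu` is exactly what makes T invertible. -/
theorem isSplitPair_thetaMap {ι β u v : K} (h2 : (2 : K) ≠ 0) (hι : ι ^ 2 = -1)
    (huv : u ^ 2 + v ^ 2 = -1) (hu : u + ι ≠ 0) :
    IsSplitPair β ι ι (thetaMap ι u v !![β, 0; 0, β⁻¹]) (thetaMap ι u v !![0, ι; ι, 0]) := by
  have hι0 : ι ≠ 0 := by rintro rfl; simp at hι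
  refine ⟨!![u + ι, v; -v, u + ι], ?_, ?_, ?_⟩
  · rw [Matrix.isUnit_iff_isUnit_det, Matrix.det_fin_two_of, isUnit_iff_ne_zero]
    have : (u + ι) * (u + ι) - v * -v = 2 * ι * (u + ι) := by
      linear_combination huv - hι
    rw [this]
    exact mul_ne_zero (mul_ne_zero h2 hι0) hu
  · rw [thetaMap_diag]
    obtain ⟨e, he⟩ : ∃ e, e = (β - β⁻¹) / (2 * ι) := ⟨_, rfl⟩
    obtain ⟨s, hs⟩ : ∃ s, s = (β + β⁻¹) / 2 := ⟨_, rfl⟩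
    rw [← he, ← hs]
    have he' : e * (2 * ι) = β - β⁻¹ := by rw [he, div_mul_cancel₀ _ (mul_ne_zero h2 hι0)]
    have hs' : s * 2 = β + β⁻¹ := by rw [hs, div_mul_cancel₀ _ h2]
    -- With β and β⁻¹ written in s, e and ι the remaining identities are polynomial.
    have hb : β = s + e * ι := mul_left_cancel₀ h2 (by linear_combination -he' - hs')
    have hb' : β⁻¹ = s - e * ι := mul_left_cancel₀ h2 (by linear_combination he' - hs')
    rw [hb', hb]
    ext i j
    fin_cases i <;> fin_cases j <;> simp [Matrix.mul_apply, Fin.sum_univ_two]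
    · linear_combination e * huv - e * hι
    · ring
    · ring
    · linear_combination -e * huv + e * hι
  · rw [thetaMap_swap h2 hι0]
    ext i j
    fin_cases i <;> fin_cases j <;> simp [Matrix.mul_apply, Fin.sum_univ_two]
    · ring
    · linear_combination huv - hι
    · linear_combination huv - hι
    · ring

theorem IsSplitPair.mul_mul {β c d : K} {A B : Mat2 K} (h : IsSplitPair β c d A B)
    (h0 : β ≠ 0) : A * B * A = B := by
  obtain ⟨T, hT, hA, hB⟩ := h
  refine hT.mul_left_cancel ?_
  rw [← mul_assoc, ← mul_assoc, hA, mul_assoc _ T B, hB, mul_assoc, mul_assoc _ T A, hA,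
    ← mul_assoc, ← mul_assoc]
  congr 1
  ext i j
  fin_cases i <;> fin_cases j <;> simp [Matrix.mul_apply, Fin.sum_univ_two] <;> field_simp

theorem IsSplitPair.sq {β c d : K} {A B : Mat2 K} (h : IsSplitPair β c d A B) :
    B ^ 2 = (c * d) • 1 := by
  obtain ⟨T, hT, hA, hB⟩ := h
  refine hT.mul_left_cancel ?_
  rw [pow_two, ← mul_assoc, hB, mul_assoc, hB, ← mul_assoc, mul_smul_comm, mul_one]
  have : (!![0, c; d, 0] * !![0, c; d, 0] : Mat2 K) = (c * d) • 1 := by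
    ext i j
    fin_cases i <;> fin_cases j <;> simp [Matrix.mul_apply, Fin.sum_univ_two, mul_comm]
  rw [this, smul_mul_assoc, one_mul]

theorem diag_pow (β γ : K) (n : ℕ) :
    (!![β, 0; 0, γ] : Mat2 K) ^ n = !![β ^ n, 0; 0, γ ^ n] := by
  induction n with
  | zero => ext i j; fin_cases i <;> fin_cases j <;> simp
  | succ n ih =>
    rw [pow_succ, ih]
    ext i j
    fin_cases i <;> fin_cases j <;> simp [Matrix.mul_apply, Fin.sum_univ_two, pow_succ]

theorem mul_pow_eq_diag_mul {β : K} {A T : Mat2 K}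
    (hA : T * A = !![β, 0; 0, β⁻¹] * T) (n : ℕ) :
    T * A ^ n = !![β ^ n, 0; 0, (β⁻¹) ^ n] * T := by
  have : SemiconjBy T A !![β, 0; 0, β⁻¹] := hA
  rw [← diag_pow]
  exact this.pow_right n

theorem IsSplitPair.pow {β c d : K} {A B : Mat2 K} (h : IsSplitPair β c d A B)
    {n : ℕ} {ε : K} (hβ : β ^ n = ε) (hε : ε ^ 2 = 1) : A ^ n = ε • 1 := by
  obtain ⟨T, hT, hA, hB⟩ := h
  refine hT.mul_left_cancel ?_
  have hβ' : (β⁻¹) ^ n = ε := by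
    rw [inv_pow, hβ]
    exact inv_eq_of_mul_eq_one_left (by rw [← hε, _root_.sq])
  rw [mul_pow_eq_diag_mul hA, hβ, hβ', mul_smul_comm, mul_one]
  ext i j
  fin_cases i <;> simp [Matrix.mul_apply, Fin.sum_univ_two]

theorem IsSplitPair.det_left {β c d : K} {A B : Mat2 K} (h : IsSplitPair β c d A B)
    (h0 : β ≠ 0) : A.det = 1 := by
  obtain ⟨T, hT, hA, hB⟩ := h
  have := congrArg Matrix.det hA
  rw [Matrix.det_mul, Matrix.det_mul, mul_comm, Matrix.det_fin_two_of] at this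
  have h2 := mul_right_cancel₀ ((Matrix.isUnit_iff_isUnit_det T).1 hT).ne_zero this
  simpa [h0] using h2

theorem IsSplitPair.det_right {β c d : K} {A B : Mat2 K} (h : IsSplitPair β c d A B) :
    B.det = -(c * d) := by
  obtain ⟨T, hT, hA, hB⟩ := h
  have := congrArg Matrix.det hB
  rw [Matrix.det_mul, Matrix.det_mul, mul_comm, Matrix.det_fin_two_of] at this
  have h2 := mul_right_cancel₀ ((Matrix.isUnit_iff_isUnit_det T).1 hT).ne_zero this
  simpa using h2

theorem aeval_diag {F : Type*} [Field F] [Algebra F K] (β γ : K) (P : F[X]) :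
    aeval (!![β, 0; 0, γ] : Mat2 K) P = !![aeval β P, 0; 0, aeval γ P] := by
  induction P using Polynomial.induction_on' with
  | add p q hp hq =>
    rw [map_add, hp, hq]
    ext i j
    fin_cases i <;> fin_cases j <;> simp
  | monomial k r =>
    rw [aeval_monomial, diag_pow, aeval_monomial, aeval_monomial, ← Algebra.smul_def]
    ext i j
    fin_cases i <;> fin_cases j <;> simp [Algebra.smul_def]

theorem mul_aeval_eq_diag_mul {F : Type*} [Field F] [Algebra F K] {β : K} {A T : Mat2 K}
    (hA : T * A = !![β, 0; 0, β⁻¹] * T) (P : F[X]) :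
    T * aeval A P = !![aeval β P, 0; 0, aeval β⁻¹ P] * T := by
  rw [← aeval_diag]
  induction P using Polynomial.induction_on' with
  | add p q hp hq => rw [map_add, map_add, mul_add, add_mul, hp, hq]
  | monomial k r =>
    have : SemiconjBy T A !![β, 0; 0, β⁻¹] := hA
    rw [aeval_monomial, aeval_monomial, ← Algebra.smul_def, ← Algebra.smul_def, mul_smul_comm,
      (this.pow_right k).eq, smul_mul_assoc]

/-- After conjugation P(A) is diagonal and B R(A) antidiagonal, so the two summands vanish
separately, entry by entry. -/
theorem IsSplitPair.aeval_eq_zero {F : Type*} [Field F] [Algebra F K] {β c d : K} {A B : Mat2 K}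
    (h : IsSplitPair β c d A B) (hcd : c * d ≠ 0) {P R : F[X]}
    (hz : aeval A P + B * aeval A R = 0) :
    (aeval β P = 0 ∧ aeval β⁻¹ P = 0) ∧ (aeval β R = 0 ∧ aeval β⁻¹ R = 0) := by
  obtain ⟨T, hT, hA, hB⟩ := h
  have key : (!![aeval β P, 0; 0, aeval β⁻¹ P] +
      !![0, c; d, 0] * !![aeval β R, 0; 0, aeval β⁻¹ R] : Mat2 K) = 0 := by
    refine hT.mul_right_cancel ?_
    have := congrArg (T * ·) hz
    simp only [mul_add, ← mul_assoc, hB, mul_zero] at this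
    rw [mul_assoc _ T, mul_aeval_eq_diag_mul hA, mul_aeval_eq_diag_mul hA] at this
    rw [add_mul, zero_mul, mul_assoc, this]
  have e := fun i j => congrFun (congrFun key i) j
  simp [Fin.forall_fin_two] at e
  have hc := left_ne_zero_of_mul hcd
  have hd := right_ne_zero_of_mul hcd
  tauto

end SplitPair

/-! ### Inversion on the group algebra and the euclidean dual. -/

section GroupAlgebra

variable {F G : Type*} [Field F] [Group G]

/-- The anti-automorphism `g ↦ g⁻¹` of a group algebra, as a map into the opposite algebra. -/
def invOp (F G : Type*) [Field F] [Group G] :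
    MonoidAlgebra F G →ₐ[F] (MonoidAlgebra F G)ᵐᵒᵖ :=
  MonoidAlgebra.lift F (MonoidAlgebra F G)ᵐᵒᵖ G
    { toFun := fun g => MulOpposite.op (MonoidAlgebra.of F G g⁻¹)
      map_one' := by simp [MonoidAlgebra.one_def]
      map_mul' := fun g h => by
        rw [← MulOpposite.op_mul, ← map_mul, mul_inv_rev] }

/-- The anti-automorphism `g ↦ g⁻¹` of a group algebra. -/
def invMap (x : MonoidAlgebra F G) : MonoidAlgebra F G := (invOp F G x).unop

theorem invMap_of (g : G) :
    invMap (MonoidAlgebra.of F G g) = MonoidAlgebra.of F G g⁻¹ := by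
  simp [invMap, invOp]

theorem invMap_single (g : G) (r : F) :
    invMap (MonoidAlgebra.single g r) = MonoidAlgebra.single g⁻¹ r := by
  simp [invMap, invOp]

theorem invMap_add (x y : MonoidAlgebra F G) : invMap (x + y) = invMap x + invMap y := by
  simp [invMap]

theorem invMap_smul (r : F) (x : MonoidAlgebra F G) : invMap (r • x) = r • invMap x := by
  simp [invMap]

theorem invMap_mul (x y : MonoidAlgebra F G) : invMap (x * y) = invMap y * invMap x := by
  simp [invMap]

theorem invMap_one : invMap (1 : MonoidAlgebra F G) = 1 := by
  simp [invMap]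

/-- By linearity it suffices to take x = r·g, where the coefficient of 1 in y·(r·g⁻¹) is r times
that of g in y. -/
theorem coeff_one_mul_invMap [Fintype G] (y x : MonoidAlgebra F G) :
    (y * invMap x).coeff 1 = ∑ g, x.coeff g * y.coeff g := by
  classical
  induction x using MonoidAlgebra.induction_linear with
  | zero =>
    have : invMap (0 : MonoidAlgebra F G) = 0 := by simp [invMap]
    simp [this]
  | add x z hx hz =>
    rw [invMap_add, mul_add, MonoidAlgebra.coeff_add, Finsupp.add_apply, hx, hz,
      ← Finset.sum_add_distrib]
    simp [add_mul]
  | single g r =>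
    rw [invMap_single, MonoidAlgebra.coeff_mul_single_apply]
    simp [Finsupp.single_apply, mul_comm]

theorem coeff_sum_smul_of {m : ℕ} (φ : Fin m ≃ G) (c : Fin m → F) (j : Fin m) :
    (∑ i, c i • MonoidAlgebra.of F G (φ i)).coeff (φ j) = c j := by
  classical
  simp [MonoidAlgebra.coeff_sum, Finsupp.single_apply, Finsupp.finsetSum_apply]

theorem mem_groupAlgebraSet_iff {m : ℕ} (φ : Fin m ≃ G) (C : Submodule F (Fin m → F))
    (x : MonoidAlgebra F G) :
    x ∈ groupAlgebraSet φ C ↔ (fun i => x.coeff (φ i)) ∈ C := by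
  constructor
  · rintro ⟨c, hcC, rfl⟩
    simpa only [coeff_sum_smul_of] using hcC
  · intro h
    refine ⟨_, h, ?_⟩
    refine MonoidAlgebra.ext (Finsupp.ext fun g => ?_)
    obtain ⟨j, rfl⟩ := φ.surjective g
    rw [coeff_sum_smul_of]

/-- The dual of a group code corresponds to the left annihilator of the image of the ideal under
`g ↦ g⁻¹`. -/
theorem mem_groupAlgebraSet_euclideanDual [Fintype G] {m : ℕ} (φ : Fin m ≃ G)
    (C : Submodule F (Fin m → F)) (I : Ideal (MonoidAlgebra F G))
    (hI : (I : Set (MonoidAlgebra F G)) = groupAlgebraSet φ C) (y : MonoidAlgebra F G) :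
    y ∈ groupAlgebraSet φ (euclideanDual C) ↔ ∀ x ∈ I, y * invMap x = 0 := by
  have hI' : ∀ x, x ∈ I ↔ (fun i => x.coeff (φ i)) ∈ C := fun x => by
    rw [← mem_groupAlgebraSet_iff, ← hI, SetLike.mem_coe]
  have hsum : ∀ x : MonoidAlgebra F G,
      ∑ i, x.coeff (φ i) * y.coeff (φ i) = (y * invMap x).coeff 1 := by
    intro x
    rw [coeff_one_mul_invMap]
    exact φ.sum_comp fun g => x.coeff g * y.coeff g
  rw [mem_groupAlgebraSet_iff]
  constructor
  · intro hy x hx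
    refine MonoidAlgebra.ext (Finsupp.ext fun g => ?_)
    -- Orthogonality gives only the coefficient of 1. Applied to gx, which is again in I, it gives
    -- the coefficient of g in y x̂.
    have h1 := I.mul_mem_left (MonoidAlgebra.of F G g) hx
    have h2 := hy _ ((hI' _).1 h1)
    rw [hsum, invMap_mul, invMap_of, ← mul_assoc, MonoidAlgebra.of_apply,
      MonoidAlgebra.coeff_mul_single_apply] at h2
    simpa using h2
  · intro hy c hc
    have hx : (∑ i, c i • MonoidAlgebra.of F G (φ i)) ∈ groupAlgebraSet φ C := ⟨c, hc, rfl⟩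
    have hx' := hx
    rw [← hI] at hx
    have h0 := hy _ hx
    have h1 := hsum (∑ i, c i • MonoidAlgebra.of F G (φ i))
    rw [h0] at h1
    simpa only [coeff_sum_smul_of, MonoidAlgebra.coeff_zero, Finsupp.zero_apply] using h1

/-- Inversion reverses products, so for x = z·d the element y x̂ is y d̂ ẑ, and the generator alone
decides. -/
theorem mem_image_euclideanDual_iff [Fintype G] {m : ℕ} (φ : Fin m ≃ G)
    (C : Submodule F (Fin m → F)) (hC : IsGroupCodeVia φ C) {D : Type*} [Ring D] [Algebra F D]
    (ψ : MonoidAlgebra F G ≃ₐ[F] D) (d : D)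
    (hd : ψ '' groupAlgebraSet φ C = (Ideal.span {d} : Ideal D)) (y : D) :
    y ∈ ψ '' groupAlgebraSet φ (euclideanDual C) ↔ y * ψ (invMap (ψ.symm d)) = 0 := by
  obtain ⟨I, hI⟩ := hC
  have hmem : ∀ x, x ∈ I ↔ ∃ z, x = z * ψ.symm d := by
    intro x
    rw [← SetLike.mem_coe, hI]
    have : x ∈ groupAlgebraSet φ C ↔ ψ x ∈ ψ '' groupAlgebraSet φ C :=
      (ψ.injective.mem_set_image).symm
    rw [this, hd, SetLike.mem_coe, Ideal.mem_span_singleton']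
    constructor
    · rintro ⟨z, hz⟩
      exact ⟨ψ.symm z, by rw [← map_mul, hz, ψ.symm_apply_apply]⟩
    · rintro ⟨z, rfl⟩
      exact ⟨ψ z, by simp⟩
  obtain ⟨w, rfl⟩ := ψ.surjective y
  rw [ψ.injective.mem_set_image, mem_groupAlgebraSet_euclideanDual φ C I hI, ← map_mul,
    EmbeddingLike.map_eq_zero_iff]
  constructor
  · intro h
    exact h _ ((hmem _).2 ⟨1, by simp⟩)
  · intro h x hx
    obtain ⟨z, rfl⟩ := (hmem x).1 hx
    rw [invMap_mul, ← mul_assoc, h, zero_mul]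

theorem exists_ideal_image {m : ℕ} (φ : Fin m ≃ G) (C : Submodule F (Fin m → F))
    (hC : IsGroupCodeVia φ C) {D : Type*} [Ring D] [Algebra F D]
    (ψ : MonoidAlgebra F G ≃ₐ[F] D) :
    ∃ J : Ideal D, ψ '' groupAlgebraSet φ C = J := by
  obtain ⟨I, hI⟩ := hC
  refine ⟨I.comap ψ.symm, ?_⟩
  rw [← hI]
  ext y
  rw [SetLike.mem_coe, Ideal.mem_comap]
  constructor
  · rintro ⟨x, hx, rfl⟩
    simpa using hx
  · intro h
    exact ⟨_, h, by simp⟩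

end GroupAlgebra

/-! ### Representations of the generalised quaternion group. -/

section Quaternion

open QuaternionGroup

theorem pow_val_mul_pow_val {M : Type*} [Monoid M] {N : ℕ} {A : M} (hA : A ^ N = 1)
    [NeZero N] {i j k : ZMod N} (h : i + j = k) :
    A ^ i.val * A ^ j.val = A ^ k.val := by
  rw [← pow_add, ← h, ZMod.val_add, ← pow_eq_pow_mod _ hA]

/-- The universal property of the generalised quaternion group. -/
def quaternionHom {M : Type*} [Monoid M] {n : ℕ} [NeZero n] (A B : M) (hA : A ^ (2 * n) = 1)
    (hB : B ^ 2 = A ^ n) (hAB : A * B * A = B) : QuaternionGroup n →* M where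
  toFun
    | a i => A ^ i.val
    | xa i => B * A ^ i.val
  map_one' := by
    rw [QuaternionGroup.one_def]
    simp
  map_mul' := by
    have hk : ∀ k : ℕ, A ^ k * B * A ^ k = B := by
      intro k
      induction k with
      | zero => simp
      | succ k ih =>
        calc A ^ (k + 1) * B * A ^ (k + 1) = A ^ k * (A * B * A) * A ^ k := by
              nth_rw 2 [pow_succ']; rw [pow_succ]; simp only [mul_assoc]
          _ = B := by rw [hAB, ih]
    -- Splitting A^j as A^i A^(j - i) lets A^i B A^i = B absorb the factor on the left, so inverses
    -- in the monoid are not needed.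
    have hij : ∀ i j : ZMod (2 * n), A ^ i.val * (B * A ^ j.val) = B * A ^ (j - i).val := by
      intro i j
      have := pow_val_mul_pow_val hA (show i + (j - i) = j by ring)
      rw [← this, ← mul_assoc, ← mul_assoc, hk]
    rintro (i | i) (j | j)
    · rw [a_mul_a]
      exact (pow_val_mul_pow_val hA rfl).symm
    · rw [a_mul_xa]
      exact (hij i j).symm
    · rw [xa_mul_a]
      change B * A ^ (i + j).val = B * A ^ i.val * A ^ j.val
      rw [mul_assoc, pow_val_mul_pow_val hA rfl]
    · rw [xa_mul_xa]
      change A ^ ((n : ZMod (2 * n)) + j - i).val = B * A ^ i.val * (B * A ^ j.val)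
      rw [mul_assoc, hij, ← mul_assoc, ← pow_two, hB]
      -- The representative of n modulo 2n is n itself since 0 < n < 2n; this matches the exponent
      -- in B² = Aⁿ.
      have hn : (n : ZMod (2 * n)).val = n :=
        ZMod.val_cast_of_lt (by have := NeZero.pos n; omega)
      have := pow_val_mul_pow_val hA (show (n : ZMod (2 * n)) + (j - i) = n + j - i by ring)
      rw [hn] at this
      exact this.symm

variable {F : Type*} [Field F] {n : ℕ}

/-- The representation of `F[Q_n]` with prescribed values on the generators. -/
def quaternionRep [NeZero n] {R : Type*} [Ring R] [Algebra F R] (A B : R)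
    (hA : A ^ (2 * n) = 1) (hB : B ^ 2 = A ^ n) (hAB : A * B * A = B) :
    MonoidAlgebra F (QuaternionGroup n) →ₐ[F] R :=
  MonoidAlgebra.lift F R _ (quaternionHom A B hA hB hAB)

theorem quaternionRep_a [NeZero n] {R : Type*} [Ring R] [Algebra F R] (A B : R)
    (hA : A ^ (2 * n) = 1) (hB : B ^ 2 = A ^ n) (hAB : A * B * A = B) :
    quaternionRep A B hA hB hAB (MonoidAlgebra.of F _ (a 1)) = A := by
  rw [quaternionRep, MonoidAlgebra.lift_of]
  change A ^ (1 : ZMod (2 * n)).val = A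
  have : Fact (1 < 2 * n) := ⟨by have := NeZero.pos n; omega⟩
  rw [ZMod.val_one, pow_one]

theorem quaternionRep_b [NeZero n] {R : Type*} [Ring R] [Algebra F R] (A B : R)
    (hA : A ^ (2 * n) = 1) (hB : B ^ 2 = A ^ n) (hAB : A * B * A = B) :
    quaternionRep A B hA hB hAB (MonoidAlgebra.of F _ (xa 0)) = B := by
  rw [quaternionRep, MonoidAlgebra.lift_of]
  change B * A ^ (0 : ZMod (2 * n)).val = B
  simp

theorem a_eq_pow [NeZero n] (i : ZMod (2 * n)) : a i = a 1 ^ i.val := by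
  rw [a_one_pow, ZMod.natCast_zmod_val]

theorem xa_eq_mul [NeZero n] (i : ZMod (2 * n)) : xa i = xa 0 * a 1 ^ i.val := by
  rw [← a_eq_pow, xa_mul_a, zero_add]

theorem quaternionAlgebra_induction [NeZero n]
    {p : MonoidAlgebra F (QuaternionGroup n) → Prop}
    (one : p 1) (ha : p (MonoidAlgebra.of F _ (a 1))) (hb : p (MonoidAlgebra.of F _ (xa 0)))
    (add : ∀ x y, p x → p y → p (x + y)) (smul : ∀ (r : F) x, p x → p (r • x))
    (mul : ∀ x y, p x → p y → p (x * y)) (x : MonoidAlgebra F (QuaternionGroup n)) : p x := by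
  have hpow : ∀ k : ℕ, p (MonoidAlgebra.of F _ (a 1 ^ k)) := by
    intro k
    induction k with
    | zero => simpa [← MonoidAlgebra.one_def] using one
    | succ k ih => rw [pow_succ, map_mul]; exact mul _ _ ih ha
  induction x using MonoidAlgebra.induction_on with
  | of g =>
    rcases g with i | i
    · rw [a_eq_pow]; exact hpow _
    · rw [xa_eq_mul, map_mul]; exact mul _ _ hb (hpow _)
  | add x y hx hy => exact add _ _ hx hy
  | smul r x hx => exact smul _ _ hx

/-- This normal form reduces injectivity of ψ to divisibility of two polynomials. -/
theorem exists_aeval_add_mul_aeval [NeZero n] (x : MonoidAlgebra F (QuaternionGroup n)) :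
    ∃ P R : F[X], x = aeval (MonoidAlgebra.of F _ (a 1)) P +
      MonoidAlgebra.of F _ (xa 0) * aeval (MonoidAlgebra.of F _ (a 1)) R := by
  induction x using MonoidAlgebra.induction_on with
  | of g =>
    rcases g with i | i
    · exact ⟨X ^ i.val, 0, by rw [a_eq_pow]; simp⟩
    · exact ⟨0, X ^ i.val, by rw [xa_eq_mul, map_mul, map_pow]; simp⟩
  | add x y hx hy =>
    obtain ⟨P, R, rfl⟩ := hx
    obtain ⟨P', R', rfl⟩ := hy
    refine ⟨P + P', R + R', ?_⟩
    rw [map_add, map_add, mul_add]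
    abel
  | smul r x hx =>
    obtain ⟨P, R, rfl⟩ := hx
    exact ⟨r • P, r • R, by rw [map_smul, map_smul, smul_add, mul_smul_comm]⟩

/-- Invariance gᵀ S g = S says S g⁻¹ = gᵀ S. Inversion and transposition both reverse products, so
the identity spreads from the two generators to the whole algebra. -/
theorem mul_map_invMap_eq_transpose_mul [NeZero n] {E : Type*} [Field E] [Algebra F E]
    (χ : MonoidAlgebra F (QuaternionGroup n) →ₐ[F] Mat2 E) (S : Mat2 E)
    (hA : (χ (MonoidAlgebra.of F _ (a 1))).transpose * S * χ (MonoidAlgebra.of F _ (a 1)) = S)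
    (hB : (χ (MonoidAlgebra.of F _ (xa 0))).transpose * S * χ (MonoidAlgebra.of F _ (xa 0)) = S)
    (x : MonoidAlgebra F (QuaternionGroup n)) :
    S * χ (invMap x) = (χ x).transpose * S := by
  have hgen : ∀ g : QuaternionGroup n, (χ (MonoidAlgebra.of F _ g)).transpose * S *
      χ (MonoidAlgebra.of F _ g) = S → S * χ (invMap (MonoidAlgebra.of F _ g)) =
        (χ (MonoidAlgebra.of F _ g)).transpose * S := by
    intro g hg
    rw [invMap_of]
    conv_lhs => rw [← hg]
    rw [mul_assoc, ← map_mul, ← map_mul, mul_inv_cancel, map_one, map_one, mul_one]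
  induction x using quaternionAlgebra_induction with
  | one => simp [invMap_one]
  | ha => exact hgen _ hA
  | hb => exact hgen _ hB
  | add x y hx hy =>
    rw [invMap_add, map_add, map_add, mul_add, Matrix.transpose_add, add_mul, hx, hy]
  | smul r x hx =>
    rw [invMap_smul, map_smul, map_smul, mul_smul_comm, hx, Matrix.transpose_smul, smul_mul_assoc]
  | mul x y hx hy =>
    rw [invMap_mul, map_mul, map_mul, ← mul_assoc, hy, mul_assoc, hx, Matrix.transpose_mul,
      mul_assoc]

/-- The counterpart for commutative components: `f` is the identity on F ⊕ F and the Frobenius on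
F(ι). -/
theorem map_invMap_eq_of_comm [NeZero n] {R : Type*} [CommRing R] [Algebra F R]
    (χ : MonoidAlgebra F (QuaternionGroup n) →ₐ[F] R) (f : R →ₐ[F] R)
    (hA : f (χ (MonoidAlgebra.of F _ (a 1))) * χ (MonoidAlgebra.of F _ (a 1)) = 1)
    (hB : f (χ (MonoidAlgebra.of F _ (xa 0))) * χ (MonoidAlgebra.of F _ (xa 0)) = 1)
    (x : MonoidAlgebra F (QuaternionGroup n)) : χ (invMap x) = f (χ x) := by
  have hgen : ∀ g : QuaternionGroup n,
      f (χ (MonoidAlgebra.of F _ g)) * χ (MonoidAlgebra.of F _ g) = 1 →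
      χ (invMap (MonoidAlgebra.of F _ g)) = f (χ (MonoidAlgebra.of F _ g)) := by
    intro g hg
    rw [invMap_of]
    calc _ = f (χ (MonoidAlgebra.of F _ g)) * χ (MonoidAlgebra.of F _ g) *
          χ (MonoidAlgebra.of F _ g⁻¹) := by rw [hg, one_mul]
      _ = _ := by
        rw [mul_assoc, ← map_mul χ, ← map_mul, mul_inv_cancel, map_one, map_one, mul_one]
  induction x using quaternionAlgebra_induction with
  | one => simp [invMap_one]
  | ha => exact hgen _ hA
  | hb => exact hgen _ hB
  | add x y hx hy => rw [invMap_add, map_add, map_add, map_add, hx, hy]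
  | smul r x hx => rw [invMap_smul, map_smul, map_smul, map_smul, hx]
  | mul x y hx hy => rw [invMap_mul, map_mul, map_mul, map_mul, hx, hy, mul_comm]

end Quaternion

/-! ### Reciprocal polynomials and the fields F(α + α⁻¹). -/

section Reciprocal

variable {F K : Type*} [Field F] [Field K] [Algebra F K]

theorem natDegree_reciprocal {f : F[X]} (h0 : f.eval 0 ≠ 0) :
    (reciprocal f).natDegree = f.natDegree := by
  rw [reciprocal, natDegree_C_mul (inv_ne_zero h0), reverse_natDegree,
    natTrailingDegree_eq_zero.2 (Or.inr (by rwa [coeff_zero_eq_eval_zero])), Nat.sub_zero]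

theorem aeval_inv_reciprocal {f : F[X]} {α : K} (hα : α ≠ 0) (h : aeval α f = 0) :
    aeval α⁻¹ (reciprocal f) = 0 := by
  let := invertibleOfNonzero hα
  have := (eval₂_reverse_eq_zero_iff (algebraMap F K) α f).2 h
  rw [invOf_eq_inv] at this
  rw [reciprocal, map_mul, aeval_def _ f.reverse, this, mul_zero]

theorem dvd_of_aeval_eq_zero {f P : F[X]} {α : K} (hf : Irreducible f) (h : aeval α f = 0)
    (hP : aeval α P = 0) : f ∣ P :=
  ((minpoly.irreducible ⟨f * C f.leadingCoeff⁻¹, monic_mul_leadingCoeff_inv hf.ne_zero, by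
    rw [eval₂_mul, ← aeval_def, h, zero_mul]⟩).associated_of_dvd hf
      (minpoly.dvd F α h)).symm.dvd.trans (minpoly.dvd F α hP)

theorem natDegree_eq_finrank {f : F[X]} {α : K} (hf : Irreducible f) (h : aeval α f = 0) :
    f.natDegree = Module.finrank F F⟮α⟯ := by
  have hint : IsIntegral F α := ⟨f * C f.leadingCoeff⁻¹, monic_mul_leadingCoeff_inv hf.ne_zero, by
    rw [eval₂_mul, ← aeval_def, h, zero_mul]⟩
  rw [IntermediateField.adjoin.finrank hint]
  exact natDegree_eq_of_degree_eq (degree_eq_degree_of_associated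
    ((minpoly.irreducible hint).associated_of_dvd hf (minpoly.dvd F α h)).symm)

theorem adjoin_inv_eq (α : K) : F⟮α⁻¹⟯ = F⟮α⟯ := by
  apply le_antisymm <;> rw [IntermediateField.adjoin_simple_le_iff]
  · exact inv_mem (IntermediateField.mem_adjoin_simple_self F α)
  · simpa using inv_mem (IntermediateField.mem_adjoin_simple_self F α⁻¹)

theorem isIntegral_of_irreducible {f : F[X]} {α : K} (hf : Irreducible f) (h : aeval α f = 0) :
    IsIntegral F α := by
  rw [← isAlgebraic_iff_isIntegral]
  exact ⟨f, hf.ne_zero, h⟩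

/-- Since F(α⁻¹) = F(α), f* has the degree of the minimal polynomial of its root α⁻¹, so the two are
associated. -/
theorem reciprocal_dvd {f P : F[X]} {α : K} (hf : Irreducible f) (h0 : f.eval 0 ≠ 0) (hα : α ≠ 0)
    (h : aeval α f = 0) (hP : aeval α⁻¹ P = 0) : reciprocal f ∣ P := by
  have hr := aeval_inv_reciprocal hα h
  have hint : IsIntegral F α := isIntegral_of_irreducible hf h
  have hne : reciprocal f ≠ 0 := by
    intro h'
    rw [reciprocal, mul_eq_zero, C_eq_zero, inv_eq_zero, reverse_eq_zero] at h'
    exact h'.elim h0 hf.ne_zero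
  have hdeg : (reciprocal f).natDegree ≤ (minpoly F α⁻¹).natDegree := by
    rw [natDegree_reciprocal h0, natDegree_eq_finrank hf h,
      ← IntermediateField.adjoin.finrank hint.inv, adjoin_inv_eq]
  exact (associated_of_dvd_of_natDegree_le (minpoly.dvd F α⁻¹ hr) hne hdeg).symm.dvd.trans
    (minpoly.dvd F α⁻¹ hP)

/-- α⁻¹ is also a root of f, so every polynomial relation over F satisfied by α is satisfied by α⁻¹.
If α = p(α + α⁻¹), exchanging α and α⁻¹ would give α⁻¹ = p(α + α⁻¹) = α. -/
theorem not_mem_adjoin_add_inv {f : F[X]} {α : K} (hf : Irreducible f)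
    (hr : reciprocal f = f) (hα : α ≠ 0) (h : aeval α f = 0) (h1 : α ≠ α⁻¹) :
    α ∉ F⟮α + α⁻¹⟯ := by
  intro hmem
  have hint : IsIntegral F α := isIntegral_of_irreducible hf h
  have hroot : ∀ g : F[X], aeval α g = 0 → aeval α⁻¹ g = 0 := by
    intro g hg
    obtain ⟨k, rfl⟩ := dvd_of_aeval_eq_zero hf h hg
    have := aeval_inv_reciprocal hα h
    rw [hr] at this
    rw [map_mul, this, zero_mul]
  have poly : ∀ x y : K, IsIntegral F x → y ∈ F⟮x⟯ → ∃ p : F[X], aeval x p = y := by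
    intro x y hx hy
    rw [← IntermediateField.mem_toSubalgebra,
      IntermediateField.adjoin_simple_toSubalgebra_of_isAlgebraic hx.isAlgebraic,
      Algebra.adjoin_singleton_eq_range_aeval] at hy
    exact hy
  obtain ⟨p, hp⟩ := poly _ _ (hint.add hint.inv) hmem
  -- k expresses inversion polynomially on the roots, which turns the relation α = p(α + α⁻¹) into a
  -- vanishing polynomial.
  obtain ⟨k, hk⟩ := poly _ _ hint (inv_mem (IntermediateField.mem_adjoin_simple_self F α))
  have hk' : aeval α⁻¹ k = α := by
    have := hroot (X * k - 1) (by simp [hk, hα])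
    simp only [map_sub, map_mul, aeval_X, map_one, sub_eq_zero] at this
    rw [inv_mul_eq_one₀ hα] at this
    exact this.symm
  have := hroot (X - p.comp (X + k)) (by simp [aeval_comp, hk, hp])
  simp only [map_sub, aeval_X, aeval_comp, map_add, hk', sub_eq_zero] at this
  rw [add_comm, hp] at this
  exact h1 this.symm

/-- α is a root of X² - (α + α⁻¹)X + 1 and does not lie in F(α + α⁻¹), so the upper step of the
tower F ⊆ F(α + α⁻¹) ⊆ F(α) has degree 2. -/
theorem natDegree_eq_two_mul_finrank {f : F[X]} {α : K} (hf : Irreducible f)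
    (hr : reciprocal f = f) (hα : α ≠ 0) (h : aeval α f = 0) (h1 : α ≠ α⁻¹) :
    f.natDegree = 2 * Module.finrank F F⟮α + α⁻¹⟯ := by
  have hint : IsIntegral F α := isIntegral_of_irreducible hf h
  have hnot := not_mem_adjoin_add_inv hf hr hα h h1
  set E := F⟮α + α⁻¹⟯ with hE
  have hle : E ≤ F⟮α⟯ := by
    rw [hE, IntermediateField.adjoin_simple_le_iff]
    exact add_mem (IntermediateField.mem_adjoin_simple_self F α)
      (inv_mem (IntermediateField.mem_adjoin_simple_self F α))
  have hintE : IsIntegral E α := hint.tower_top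
  have h2 : Module.finrank E E⟮α⟯ = 2 := by
    rw [IntermediateField.adjoin.finrank hintE]
    apply le_antisymm
    · have hs : α + α⁻¹ ∈ E := IntermediateField.mem_adjoin_simple_self F _
      let g : E[X] := X ^ 2 - C ⟨α + α⁻¹, hs⟩ * X + 1
      have hg : aeval α g = 0 := by
        have : algebraMap E K ⟨α + α⁻¹, hs⟩ = α + α⁻¹ := rfl
        simp only [g, map_add, map_sub, map_mul, map_pow, aeval_X, aeval_C, map_one, this]
        field_simp
        ring
      have hdeg : g.natDegree = 2 := by simp only [g]; compute_degree!
      have hg0 : g ≠ 0 := by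
        intro h
        rw [h] at hdeg
        simp at hdeg
      exact (natDegree_le_of_dvd (minpoly.dvd E α hg) hg0).trans hdeg.le
    · rw [minpoly.two_le_natDegree_iff hintE]
      rintro ⟨x, hx⟩
      exact hnot (hx ▸ x.2)
  have h3 : (E⟮α⟯).restrictScalars F = F⟮α⟯ := by
    apply le_antisymm
    · intro x hx
      rw [IntermediateField.mem_restrictScalars] at hx
      have : E⟮α⟯ ≤ IntermediateField.extendScalars hle := by
        rw [IntermediateField.adjoin_simple_le_iff, IntermediateField.mem_extendScalars]
        exact IntermediateField.mem_adjoin_simple_self F α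
      exact this hx
    · rw [IntermediateField.adjoin_simple_le_iff, IntermediateField.mem_restrictScalars]
      exact IntermediateField.mem_adjoin_simple_self E α
  have h4 : Module.finrank F F⟮α⟯ = Module.finrank F E⟮α⟯ := by
    rw [← h3]
    rfl
  rw [natDegree_eq_finrank hf h, h4, ← Module.finrank_mul_finrank F E E⟮α⟯, h2, mul_comm]

theorem sqrt_mem {E : IntermediateField F K} {x : E} {r : K} (hr : r ^ 2 = x) (h : IsSquare x) :
    r ∈ E := by
  obtain ⟨y, rfl⟩ := h
  have : r ^ 2 = (y : K) ^ 2 := by rw [hr, pow_two]; rfl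
  rcases sq_eq_sq_iff_eq_or_eq_neg.1 this with h | h
  · rw [h]; exact y.2
  · rw [h]; exact neg_mem y.2

theorem finrank_adjoin_iota_le {ι : K} (hι : ι ^ 2 = -1) :
    FiniteDimensional F F⟮ι⟯ ∧ Module.finrank F F⟮ι⟯ ≤ 2 := by
  have hdeg : (X ^ 2 + 1 : F[X]).natDegree = 2 := by compute_degree!
  have hm : (X ^ 2 + 1 : F[X]).Monic := by monicity!
  have hr : aeval ι (X ^ 2 + 1 : F[X]) = 0 := by simp [hι]
  have hint : IsIntegral F ι := ⟨_, hm, hr⟩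
  refine ⟨IntermediateField.adjoin.finiteDimensional hint, ?_⟩
  rw [IntermediateField.adjoin.finrank hint, ← hdeg]
  exact natDegree_le_of_dvd (minpoly.dvd F ι hr) hm.ne_zero

end Reciprocal

/-! ### Squares in finite extensions when q ≡ 3 mod 4. -/

section FiniteField

variable {F K : Type*} [Field F] [Fintype F] [Field K] [Algebra F K]

/-- Shaped after the criterion `FiniteField.isSquare_neg_one_iff`, applied to a field with q ^ m
elements. -/
theorem pow_mod_four {q : ℕ} (hq : q ≡ 3 [MOD 4]) (m : ℕ) : q ^ m % 4 ≠ 3 ↔ Even m := by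
  have h2 : q ^ 2 ≡ 1 [MOD 4] := (hq.pow 2).trans rfl
  rcases Nat.even_or_odd m with ⟨k, rfl⟩ | ⟨k, rfl⟩
  · have : q ^ (k + k) ≡ 1 [MOD 4] := by
      rw [← two_mul, pow_mul]
      simpa using h2.pow k
    rw [this]
    simp
  · have : q ^ (2 * k + 1) ≡ 3 [MOD 4] := by
      rw [pow_succ, pow_mul]
      simpa using (h2.pow k).mul hq
    rw [this]
    simp

theorem isSquare_neg_one_iff_even (hq : Fintype.card F ≡ 3 [MOD 4])
    (E : IntermediateField F K) [FiniteDimensional F E] :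
    IsSquare (-1 : E) ↔ Even (Module.finrank F E) := by
  classical
  have : Finite E := Module.finite_of_finite F
  let : Fintype E := Fintype.ofFinite E
  rw [FiniteField.isSquare_neg_one_iff, Module.card_eq_pow_finrank (K := F), pow_mod_four hq]

theorem iota_mem_iff_even (hq : Fintype.card F ≡ 3 [MOD 4]) {ι : K} (hι : ι ^ 2 = -1)
    (E : IntermediateField F K) [FiniteDimensional F E] :
    ι ∈ E ↔ Even (Module.finrank F E) := by
  rw [← isSquare_neg_one_iff_even hq]
  constructor
  · intro h
    refine ⟨⟨ι, h⟩, Subtype.ext ?_⟩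
    simpa [pow_two] using hι.symm
  · intro h
    exact sqrt_mem (by simpa using hι) h

theorem isSquare_mul_of_not_isSquare {E : Type*} [Field E] [Finite E]
    {x y : E} (hx : ¬ IsSquare x) (hy : ¬ IsSquare y) : IsSquare (x * y) := by
  classical
  let := Fintype.ofFinite E
  have hx0 : x ≠ 0 := by rintro rfl; exact hx (IsSquare.zero)
  have hy0 : y ≠ 0 := by rintro rfl; exact hy (IsSquare.zero)
  rw [← quadraticChar_one_iff_isSquare (mul_ne_zero hx0 hy0), map_mul,
    quadraticChar_neg_one_iff_not_isSquare.2 hx, quadraticChar_neg_one_iff_not_isSquare.2 hy]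
  norm_num

/-- The square of β - β⁻¹ is (β + β⁻¹)² - 4, a nonsquare of E because β is not in E. In odd degree
-1 is a nonsquare too, so the product, which is the square of (β - β⁻¹)/ι, is a square in E. -/
theorem sub_inv_div_mem (hq : Fintype.card F ≡ 3 [MOD 4]) (h2 : (2 : K) ≠ 0) {ι : K}
    (hι : ι ^ 2 = -1) {β : K} (hβ : β ≠ 0) (E : IntermediateField F K) [FiniteDimensional F E]
    (hs : β + β⁻¹ ∈ E) (hβE : β ∉ E) (hodd : ¬ Even (Module.finrank F E)) :
    (β - β⁻¹) / (2 * ι) ∈ E := by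
  have : Finite E := Module.finite_of_finite F
  have hι0 : ι ≠ 0 := by rintro rfl; simp at hι
  have h2E : (2 : K) ∈ E := ofNat_mem E 2
  let x : E := ⟨β + β⁻¹, hs⟩ ^ 2 - 4
  have hx : (x : K) = (β - β⁻¹) ^ 2 := by
    have : (x : K) = (β + β⁻¹) ^ 2 - 4 := rfl
    rw [this]
    field_simp
    ring
  have hxs : ¬ IsSquare x := by
    intro h
    have hd : β - β⁻¹ ∈ E := sqrt_mem hx.symm h
    apply hβE
    have : β = ((β + β⁻¹) + (β - β⁻¹)) / 2 := by
      rw [eq_div_iff h2]; ring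
    rw [this]
    exact div_mem (add_mem hs hd) h2E
  have h1 : ¬ IsSquare (-1 : E) := by rwa [isSquare_neg_one_iff_even hq]
  have hmem : (β - β⁻¹) / ι ∈ E := by
    refine sqrt_mem (x := x * -1) ?_ (isSquare_mul_of_not_isSquare hxs h1)
    rw [div_pow, hι, ← hx]
    simp [div_neg]
  have : (β - β⁻¹) / (2 * ι) = (β - β⁻¹) / ι / 2 := by rw [div_div, mul_comm]
  rw [this]
  exact div_mem hmem h2E

end FiniteField

/-! ### Roots and degrees in the factorisation of xⁿ - ε. -/

section Factorization

variable {F K : Type*} [Field F] [Field K] [Algebra F K] {ℓ P : F[X]} {n : ℕ} {ε : F}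

theorem squarefree_X_pow_sub_C (hn : (n : F) ≠ 0) (hε : ε ≠ 0) :
    Squarefree (X ^ n - C ε : F[X]) :=
  (separable_X_pow_sub_C ε hn hε).squarefree

namespace RecipFactorization

theorem selfFactor_dvd (fx : RecipFactorization F K ℓ P) (i : Fin fx.numSelf) :
    ℓ * fx.selfFactor i ∣ P := by
  conv_rhs => rw [fx.prod_eq]
  exact (mul_dvd_mul_left _ (Finset.dvd_prod_of_mem _ (Finset.mem_univ i))).trans
    (dvd_mul_right _ _)

theorem pairFactor_dvd (fx : RecipFactorization F K ℓ P) (i : Fin fx.numPair) :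
    fx.pairFactor i ∣ P := by
  conv_rhs => rw [fx.prod_eq]
  exact ((dvd_mul_right _ _).trans (Finset.dvd_prod_of_mem
    (fun i => fx.pairFactor i * reciprocal (fx.pairFactor i)) (Finset.mem_univ i))).trans
    (dvd_mul_left _ _)

theorem pow_eq_of_aeval {f : F[X]} {α : K} (hP : P = X ^ n - C ε) (hf : f ∣ P)
    (h : aeval α f = 0) : α ^ n = algebraMap F K ε := by
  obtain ⟨g, hg⟩ := hf
  have : aeval α P = 0 := by rw [hg, map_mul, h, zero_mul]
  rw [hP] at this
  simpa [sub_eq_zero] using this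

theorem selfRoot_pow (fx : RecipFactorization F K ℓ P) (hP : P = X ^ n - C ε)
    (i : Fin fx.numSelf) : fx.selfRoot i ^ n = algebraMap F K ε :=
  pow_eq_of_aeval hP ((dvd_mul_left _ _).trans (fx.selfFactor_dvd i)) (fx.selfRoot_isRoot i)

theorem pairRoot_pow (fx : RecipFactorization F K ℓ P) (hP : P = X ^ n - C ε)
    (i : Fin fx.numPair) : fx.pairRoot i ^ n = algebraMap F K ε :=
  pow_eq_of_aeval hP (fx.pairFactor_dvd i) (fx.pairRoot_isRoot i)

theorem ne_zero_of_pow_eq {α : K} (hn : n ≠ 0) (hε : ε ≠ 0) (h : α ^ n = algebraMap F K ε) :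
    α ≠ 0 := by
  rintro rfl
  rw [zero_pow hn] at h
  exact hε ((map_eq_zero _).1 h.symm)

theorem selfRoot_ne_zero (fx : RecipFactorization F K ℓ P) (hP : P = X ^ n - C ε)
    (hn : n ≠ 0) (hε : ε ≠ 0) (i : Fin fx.numSelf) : fx.selfRoot i ≠ 0 :=
  ne_zero_of_pow_eq hn hε (fx.selfRoot_pow hP i)

theorem pairRoot_ne_zero (fx : RecipFactorization F K ℓ P) (hP : P = X ^ n - C ε)
    (hn : n ≠ 0) (hε : ε ≠ 0) (i : Fin fx.numPair) : fx.pairRoot i ≠ 0 :=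
  ne_zero_of_pow_eq hn hε (fx.pairRoot_pow hP i)

/-- If α² = 1, then oddness of n gives α = αⁿ = ε, so the factor divides ℓ and its square divides
the squarefree P. -/
theorem selfRoot_ne_inv (fx : RecipFactorization F K ℓ P) (hP : P = X ^ n - C ε)
    (hℓ : ℓ = X - C ε) (hn : Odd n) (hnF : (n : F) ≠ 0) (hε : ε ≠ 0) (i : Fin fx.numSelf) :
    fx.selfRoot i ≠ (fx.selfRoot i)⁻¹ := by
  intro h
  have h0 := fx.selfRoot_ne_zero hP hn.pos.ne' hε i
  have hsq : fx.selfRoot i ^ 2 = 1 := by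
    rw [pow_two]
    nth_rw 1 [h]
    exact inv_mul_cancel₀ h0
  have hpow := fx.selfRoot_pow hP i
  obtain ⟨k, rfl⟩ := hn
  rw [pow_succ, pow_mul, hsq, one_pow, one_mul] at hpow
  have hd : fx.selfFactor i ∣ ℓ := by
    refine dvd_of_aeval_eq_zero (fx.selfFactor_irreducible i) (fx.selfRoot_isRoot i) ?_
    have : aeval (fx.selfRoot i) (X - C ε) = 0 := by simp [hpow]
    rwa [← hℓ] at this
  have hsqf := squarefree_X_pow_sub_C hnF hε
  rw [← hP] at hsqf
  exact (fx.selfFactor_irreducible i).not_isUnit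
    (hsqf _ ((mul_dvd_mul_right hd _).trans (fx.selfFactor_dvd i)))

theorem pairFactor_eval_zero (fx : RecipFactorization F K ℓ P) (hP : P = X ^ n - C ε)
    (hn : n ≠ 0) (hε : ε ≠ 0) (i : Fin fx.numPair) : (fx.pairFactor i).eval 0 ≠ 0 := by
  intro h
  obtain ⟨g, hg⟩ := fx.pairFactor_dvd i
  have : P.eval 0 = 0 := by rw [hg, eval_mul, h, zero_mul]
  rw [hP] at this
  simp [hn, hε] at this

/-- Each listed factor divides R, so P divides a power of R; squarefreeness of P removes the
exponent without any coprimality between the factors. -/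
theorem dvd_of_aeval (fx : RecipFactorization F K ℓ P) (hP : P = X ^ n - C ε)
    (hℓ : ℓ = X - C ε) (hn : n ≠ 0) (hnF : (n : F) ≠ 0) (hε : ε ≠ 0) {R : F[X]}
    (h0 : aeval ε R = 0) (hs : ∀ i, aeval (fx.selfRoot i) R = 0)
    (hp : ∀ i, aeval (fx.pairRoot i) R = 0 ∧ aeval (fx.pairRoot i)⁻¹ R = 0) : P ∣ R := by
  have hsqf : Squarefree P := by
    rw [hP]
    exact squarefree_X_pow_sub_C hnF hε
  have hprod : P ∣ R * (∏ _i : Fin fx.numSelf, R) * ∏ _i : Fin fx.numPair, (R * R) := by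
    conv_lhs => rw [fx.prod_eq]
    refine mul_dvd_mul (mul_dvd_mul ?_ ?_) ?_
    · have : X - C ε ∣ R := by
        rw [dvd_iff_isRoot]
        simpa [aeval_def] using h0
      rwa [← hℓ] at this
    · exact Finset.prod_dvd_prod_of_dvd _ _ fun i _ =>
        dvd_of_aeval_eq_zero (fx.selfFactor_irreducible i) (fx.selfRoot_isRoot i) (hs i)
    · exact Finset.prod_dvd_prod_of_dvd _ _ fun i _ => mul_dvd_mul
        (dvd_of_aeval_eq_zero (fx.pairFactor_irreducible i) (fx.pairRoot_isRoot i) (hp i).1)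
        (reciprocal_dvd (fx.pairFactor_irreducible i) (fx.pairFactor_eval_zero hP hn hε i)
          (fx.pairRoot_ne_zero hP hn hε i) (fx.pairRoot_isRoot i) (hp i).2)
  simp only [Finset.prod_const, ← pow_two, ← pow_mul, ← pow_succ', ← pow_add] at hprod
  exact hsqf.isRadical _ _ hprod

theorem natDegree_sum (fx : RecipFactorization F K ℓ P) (hP : P = X ^ n - C ε)
    (hℓ : ℓ = X - C ε) (hn : n ≠ 0) (hε : ε ≠ 0) :
    n = 1 + ∑ i, (fx.selfFactor i).natDegree + ∑ i, 2 * (fx.pairFactor i).natDegree := by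
  have hdeg : P.natDegree = n := by rw [hP, natDegree_X_pow_sub_C]
  have hP0 : P ≠ 0 := by
    intro h
    rw [h, natDegree_zero] at hdeg
    exact hn hdeg.symm
  have heq := fx.prod_eq
  have h12 : ℓ * (∏ i, fx.selfFactor i) ≠ 0 := fun h => hP0 (by rw [heq, h, zero_mul])
  have h3 : ∏ i, (fx.pairFactor i * reciprocal (fx.pairFactor i)) ≠ 0 :=
    fun h => hP0 (by rw [heq, h, mul_zero])
  have key := congrArg natDegree heq
  rw [hdeg, natDegree_mul h12 h3, natDegree_mul (left_ne_zero_of_mul h12)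
    (right_ne_zero_of_mul h12), natDegree_prod _ _ fun i _ => (fx.selfFactor_irreducible i).ne_zero,
    natDegree_prod _ _ fun i _ => Finset.prod_ne_zero_iff.1 h3 i (Finset.mem_univ i),
    show ℓ.natDegree = 1 by rw [hℓ, natDegree_X_sub_C]] at key
  rw [key]
  congr 1
  refine Finset.sum_congr rfl fun i _ => ?_
  have := Finset.prod_ne_zero_iff.1 h3 i (Finset.mem_univ i)
  rw [natDegree_mul (left_ne_zero_of_mul this) (right_ne_zero_of_mul this),
    natDegree_reciprocal (fx.pairFactor_eval_zero hP hn hε i), two_mul]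

end RecipFactorization

end Factorization

open QuaternionGroup

/-! ### Descent of the generator matrices to the intermediate fields. -/

section Components

variable {F K : Type*} [Field F] [Field K] [Algebra F K]

theorem toK_injective {E : IntermediateField F K} : Function.Injective (toK : Mat2 E → Mat2 K) :=
  Matrix.map_injective (algebraMap E K).injective

/-- `toK` as an algebra homomorphism. -/
abbrev toKHom (E : IntermediateField F K) : Mat2 E →ₐ[F] Mat2 K := E.val.mapMatrix

theorem toKHom_apply {E : IntermediateField F K} (X : Mat2 E) : toKHom E X = toK X := rfl

theorem toK_of {E : IntermediateField F K} (a b c d : E) :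
    toK !![a, b; c, d] = !![(a : K), (b : K); (c : K), (d : K)] := by
  ext i j
  fin_cases i <;> fin_cases j <;> rfl

/-- The relations are checked after conjugation over `K` and return to E by injectivity of `toK`. -/
theorem relations_of_isSplitPair {E : IntermediateField F K} {A B : Mat2 E} {β c d ε : K} {n : ℕ}
    (h : IsSplitPair β c d (toK A) (toK B)) (hβ : β ≠ 0) (hpow : β ^ n = ε) (hcd : c * d = ε)
    (hε : ε ^ 2 = 1) : A ^ (2 * n) = 1 ∧ B ^ 2 = A ^ n ∧ A * B * A = B := by
  have h1 := h.pow hpow hε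
  have h2 := h.sq
  have h3 := h.mul_mul hβ
  simp only [← toKHom_apply, ← map_pow, ← map_mul] at h1 h2 h3
  have hinj : Function.Injective (toKHom E) := toK_injective
  refine ⟨hinj ?_, hinj ?_, hinj h3⟩
  · rw [mul_comm, pow_mul, map_pow, h1, map_one, _root_.smul_pow, one_pow, hε, one_smul]
  · rw [h2, h1, hcd]

theorem exists_sigmaMap {α : K} (h0 : α ≠ 0) (h1 : α ≠ α⁻¹) :
    ∃ A B : Mat2 F⟮α + α⁻¹⟯, toK A = sigmaMap α !![α, 0; 0, α⁻¹] ∧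
      toK B = sigmaMap α !![0, 1; 1, 0] := by
  let s : F⟮α + α⁻¹⟯ := IntermediateField.AdjoinSimple.gen F (α + α⁻¹)
  have hs : (s : K) = α + α⁻¹ := rfl
  refine ⟨!![0, 1; -1, s], !![1, -s; 0, -1], ?_, ?_⟩
  · rw [sigmaMap_diag h0 h1, toK_of]
    simp [hs]
  · rw [sigmaMap_swap h1, toK_of]
    simp [hs]

theorem exists_gammaMap {ι β : K} (hι : ι ^ 2 = -1) (h0 : β ≠ 0) (h1 : β ≠ β⁻¹)
    (hmem : ι ∈ F⟮β + β⁻¹⟯) :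
    ∃ A B : Mat2 F⟮β + β⁻¹⟯, toK A = gammaMap ι β !![β, 0; 0, β⁻¹] ∧
      toK B = gammaMap ι β !![0, ι; ι, 0] := by
  let s : F⟮β + β⁻¹⟯ := IntermediateField.AdjoinSimple.gen F (β + β⁻¹)
  have hs : (s : K) = β + β⁻¹ := rfl
  let i : F⟮β + β⁻¹⟯ := ⟨ι, hmem⟩
  refine ⟨!![0, -i; -i, s], !![i, -s; 0, -i], ?_, ?_⟩
  · rw [gammaMap_diag hι h0 h1, toK_of]
    simp [i, hs]
  · rw [gammaMap_swap hι h1, toK_of]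
    simp [i, hs]

theorem exists_thetaMap {ι β : K} (h2 : (2 : K) ≠ 0) (hι : ι ≠ 0) (u v : F⟮β + β⁻¹⟯)
    (hmem : (β - β⁻¹) / (2 * ι) ∈ F⟮β + β⁻¹⟯) :
    ∃ A B : Mat2 F⟮β + β⁻¹⟯, toK A = thetaMap ι u v !![β, 0; 0, β⁻¹] ∧
      toK B = thetaMap ι u v !![0, ι; ι, 0] := by
  let s : F⟮β + β⁻¹⟯ := IntermediateField.AdjoinSimple.gen F (β + β⁻¹)
  have hs : (s : K) = β + β⁻¹ := rfl
  let e : F⟮β + β⁻¹⟯ := ⟨(β - β⁻¹) / (2 * ι), hmem⟩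
  have he : (e : K) = (β - β⁻¹) / (2 * ι) := rfl
  refine ⟨!![s / 2 + e * u, e * v; e * v, s / 2 - e * u], !![-v, u; u, v], ?_, ?_⟩
  · rw [thetaMap_diag, toK_of]
    push_cast
    rw [hs, he]
    rfl
  · rw [thetaMap_swap h2 hι, toK_of]
    push_cast
    rfl

theorem exists_diag {β : K} (c d : F) :
    ∃ A B : Mat2 F⟮β⟯, toK A = !![β, 0; 0, β⁻¹] ∧
      toK B = !![0, algebraMap F K c; algebraMap F K d, 0] := by
  let s : F⟮β⟯ := IntermediateField.AdjoinSimple.gen F β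
  refine ⟨!![s, 0; 0, s⁻¹], !![0, algebraMap F _ c; algebraMap F _ d, 0], ?_, ?_⟩
  · rw [toK_of]
    simp [s]
  · rw [toK_of]
    simp

end Components

/-! ### Injectivity of homomorphisms with split components. -/

section SplitHom

variable {F K : Type*} [Field F] [Field K] [Algebra F K]
  {ℓ P ℓ' P' : F[X]} {fx : RecipFactorization F K ℓ P} {gx : RecipFactorization F K ℓ' P'} {ι : K}

/-- The projection to a component of the first kind. -/
def projFirst (fx : RecipFactorization F K ℓ P) (gx : RecipFactorization F K ℓ' P') (ι : K) :
    Decomp fx gx ι →ₐ[F] F × F :=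
  (AlgHom.fst F _ _).comp (AlgHom.fst F _ _)

/-- The projection to a self-reciprocal dihedral component. -/
def projDihSelf (fx : RecipFactorization F K ℓ P) (gx : RecipFactorization F K ℓ' P') (ι : K)
    (i : Fin fx.numSelf) : Decomp fx gx ι →ₐ[F] Mat2 (fx.SelfField i) :=
  (Pi.evalAlgHom F (fun i => Mat2 (fx.SelfField i)) i).comp
    ((AlgHom.fst F _ _).comp ((AlgHom.snd F _ _).comp (AlgHom.fst F _ _)))

/-- The projection to a dihedral component of a reciprocal pair. -/
def projDihPair (fx : RecipFactorization F K ℓ P) (gx : RecipFactorization F K ℓ' P') (ι : K)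
    (i : Fin fx.numPair) : Decomp fx gx ι →ₐ[F] Mat2 (fx.PairField i) :=
  (Pi.evalAlgHom F (fun i => Mat2 (fx.PairField i)) i).comp
    ((AlgHom.snd F _ _).comp ((AlgHom.snd F _ _).comp (AlgHom.fst F _ _)))

/-- The projection to `F(ι)`. -/
def projSecond (fx : RecipFactorization F K ℓ P) (gx : RecipFactorization F K ℓ' P') (ι : K) :
    Decomp fx gx ι →ₐ[F] F⟮ι⟯ :=
  (AlgHom.fst F _ _).comp (AlgHom.snd F _ _)

/-- The projection to a self-reciprocal quaternion component. -/
def projQuatSelf (fx : RecipFactorization F K ℓ P) (gx : RecipFactorization F K ℓ' P') (ι : K)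
    (i : Fin gx.numSelf) : Decomp fx gx ι →ₐ[F] Mat2 (gx.SelfField i) :=
  (Pi.evalAlgHom F (fun i => Mat2 (gx.SelfField i)) i).comp
    ((AlgHom.fst F _ _).comp ((AlgHom.snd F _ _).comp (AlgHom.snd F _ _)))

/-- The projection to a quaternion component of a reciprocal pair. -/
def projQuatPair (fx : RecipFactorization F K ℓ P) (gx : RecipFactorization F K ℓ' P') (ι : K)
    (i : Fin gx.numPair) : Decomp fx gx ι →ₐ[F] Mat2 (gx.PairField i) :=
  (Pi.evalAlgHom F (fun i => Mat2 (gx.PairField i)) i).comp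
    ((AlgHom.snd F _ _).comp ((AlgHom.snd F _ _).comp (AlgHom.snd F _ _)))

/-- A homomorphism `F[Q_n] → ⨁ A_i ⊕ ⨁ B_j` whose components are conjugate, over `K`, to the
standard representations. -/
structure IsSplitHom {n : ℕ}
    (ψ : MonoidAlgebra F (QuaternionGroup n) →ₐ[F] Decomp fx gx ι) : Prop where
  first_a : (ψ (MonoidAlgebra.of F _ (a 1))).1.1 = (1, 1)
  first_b : (ψ (MonoidAlgebra.of F _ (xa 0))).1.1 = (1, -1)
  dihSelf : ∀ i, IsSplitPair (fx.selfRoot i) 1 1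
    (toK ((ψ (MonoidAlgebra.of F _ (a 1))).1.2.1 i))
    (toK ((ψ (MonoidAlgebra.of F _ (xa 0))).1.2.1 i))
  dihPair : ∀ i, IsSplitPair (fx.pairRoot i) 1 1
    (toK ((ψ (MonoidAlgebra.of F _ (a 1))).1.2.2 i))
    (toK ((ψ (MonoidAlgebra.of F _ (xa 0))).1.2.2 i))
  second_a : (ψ (MonoidAlgebra.of F _ (a 1))).2.1 = -1
  second_b : (((ψ (MonoidAlgebra.of F _ (xa 0))).2.1 : F⟮ι⟯) : K) = ι
  quatSelf : ∀ j, IsSplitPair (gx.selfRoot j) ι ι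
    (toK ((ψ (MonoidAlgebra.of F _ (a 1))).2.2.1 j))
    (toK ((ψ (MonoidAlgebra.of F _ (xa 0))).2.2.1 j))
  quatPair : ∀ j, IsSplitPair (gx.pairRoot j) (-1) 1
    (toK ((ψ (MonoidAlgebra.of F _ (a 1))).2.2.2 j))
    (toK ((ψ (MonoidAlgebra.of F _ (xa 0))).2.2.2 j))

theorem map_aeval_add {n : ℕ} {R : Type*} [Ring R] [Algebra F R]
    (Θ : MonoidAlgebra F (QuaternionGroup n) →ₐ[F] R) (p r : F[X]) :
    Θ (aeval (MonoidAlgebra.of F _ (a 1)) p +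
      MonoidAlgebra.of F _ (xa 0) * aeval (MonoidAlgebra.of F _ (a 1)) r) =
      aeval (Θ (MonoidAlgebra.of F _ (a 1))) p +
        Θ (MonoidAlgebra.of F _ (xa 0)) * aeval (Θ (MonoidAlgebra.of F _ (a 1))) r := by
  rw [map_add, map_mul, ← aeval_algHom_apply, ← aeval_algHom_apply]

theorem aeval_add_eq_zero {n : ℕ} {D R : Type*} [Ring D] [Algebra F D] [Ring R] [Algebra F R]
    {ψ : MonoidAlgebra F (QuaternionGroup n) →ₐ[F] D} (π : D →ₐ[F] R) {p r : F[X]}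
    (h : ψ (aeval (MonoidAlgebra.of F _ (a 1)) p +
      MonoidAlgebra.of F _ (xa 0) * aeval (MonoidAlgebra.of F _ (a 1)) r) = 0) :
    aeval (π (ψ (MonoidAlgebra.of F _ (a 1)))) p +
      π (ψ (MonoidAlgebra.of F _ (xa 0))) *
        aeval (π (ψ (MonoidAlgebra.of F _ (a 1)))) r = 0 := by
  have := map_aeval_add (π.comp ψ) p r
  rw [AlgHom.comp_apply, h, map_zero] at this
  exact this.symm

theorem aeval_eq_zero_of_component {n : ℕ} {E : IntermediateField F K}
    (Θ : MonoidAlgebra F (QuaternionGroup n) →ₐ[F] Mat2 E) {β c d : K}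
    (h : IsSplitPair β c d (toK (Θ (MonoidAlgebra.of F _ (a 1))))
      (toK (Θ (MonoidAlgebra.of F _ (xa 0))))) (hcd : c * d ≠ 0) {p r : F[X]}
    (hz : Θ (aeval (MonoidAlgebra.of F _ (a 1)) p +
      MonoidAlgebra.of F _ (xa 0) * aeval (MonoidAlgebra.of F _ (a 1)) r) = 0) :
    (aeval β p = 0 ∧ aeval β⁻¹ p = 0) ∧ (aeval β r = 0 ∧ aeval β⁻¹ r = 0) := by
  refine h.aeval_eq_zero hcd ?_
  have := map_aeval_add ((toKHom E).comp Θ) p r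
  rw [AlgHom.comp_apply, hz, map_zero] at this
  exact this.symm

theorem IsSplitHom.injective {n : ℕ} [NeZero n] {fx : RecipFactorization F K (X - 1) (X ^ n - 1)}
    {gx : RecipFactorization F K (X + 1) (X ^ n + 1)}
    {ψ : MonoidAlgebra F (QuaternionGroup n) →ₐ[F] Decomp fx gx ι} (hψ : IsSplitHom ψ)
    (h2 : (2 : F) ≠ 0) (hn : (n : F) ≠ 0) (hι : ι ^ 2 = -1) (hF : ¬ IsSquare (-1 : F)) :
    Function.Injective ψ := by
  have hn0 : n ≠ 0 := NeZero.ne n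
  rw [injective_iff_map_eq_zero]
  intro x hx
  obtain ⟨p, r, rfl⟩ := exists_aeval_add_mul_aeval x
  have comp : ∀ {R : Type _} [Ring R] [Algebra F R] (π : Decomp fx gx ι →ₐ[F] R),
      (π.comp ψ) (aeval (MonoidAlgebra.of F _ (a 1)) p +
        MonoidAlgebra.of F _ (xa 0) * aeval (MonoidAlgebra.of F _ (a 1)) r) = 0 := by
    intro R _ _ π
    rw [AlgHom.comp_apply, hx, map_zero]
  have h11 : (1 : K) * 1 ≠ 0 := by simp
  have hιι : ι * ι ≠ 0 := by rw [← pow_two, hι]; simp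
  have hm1 : (-1 : K) * 1 ≠ 0 := by simp
  have dS := fun i => aeval_eq_zero_of_component ((projDihSelf fx gx ι i).comp ψ)
    (hψ.dihSelf i) h11 (comp _)
  have dP := fun i => aeval_eq_zero_of_component ((projDihPair fx gx ι i).comp ψ)
    (hψ.dihPair i) h11 (comp _)
  have qS := fun i => aeval_eq_zero_of_component ((projQuatSelf fx gx ι i).comp ψ)
    (hψ.quatSelf i) hιι (comp _)
  have qP := fun i => aeval_eq_zero_of_component ((projQuatPair fx gx ι i).comp ψ)
    (hψ.quatPair i) hm1 (comp _)
  have f1 : aeval (1 : F) p + aeval (1 : F) r = 0 := by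
    have := aeval_add_eq_zero ((AlgHom.fst F F F).comp (projFirst fx gx ι)) hx
    have ea : ((AlgHom.fst F F F).comp (projFirst fx gx ι))
        (ψ (MonoidAlgebra.of F _ (a 1))) = 1 := congrArg Prod.fst hψ.first_a
    have eb : ((AlgHom.fst F F F).comp (projFirst fx gx ι))
        (ψ (MonoidAlgebra.of F _ (xa 0))) = 1 := congrArg Prod.fst hψ.first_b
    rwa [ea, eb, one_mul] at this
  have f2 : aeval (1 : F) p - aeval (1 : F) r = 0 := by
    have := aeval_add_eq_zero ((AlgHom.snd F F F).comp (projFirst fx gx ι)) hx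
    have ea : ((AlgHom.snd F F F).comp (projFirst fx gx ι))
        (ψ (MonoidAlgebra.of F _ (a 1))) = 1 := congrArg Prod.snd hψ.first_a
    have eb : ((AlgHom.snd F F F).comp (projFirst fx gx ι))
        (ψ (MonoidAlgebra.of F _ (xa 0))) = -1 := congrArg Prod.snd hψ.first_b
    rwa [ea, eb, neg_one_mul, ← sub_eq_add_neg] at this
  have p1 : aeval (1 : F) p = 0 := by
    have : 2 * aeval (1 : F) p = 0 := by linear_combination f1 + f2
    simpa [h2] using this
  have r1 : aeval (1 : F) r = 0 := by linear_combination f1 - p1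
  have s1 : algebraMap F K (aeval (-1 : F) p) + ι * algebraMap F K (aeval (-1 : F) r) = 0 := by
    have := aeval_add_eq_zero ((IntermediateField.val _).comp (projSecond fx gx ι)) hx
    have ea : ((IntermediateField.val _).comp (projSecond fx gx ι))
        (ψ (MonoidAlgebra.of F _ (a 1))) = algebraMap F K (-1) := by
      have := congrArg (IntermediateField.val _) hψ.second_a
      rw [map_neg, map_one] at this
      rw [map_neg, map_one]
      exact this
    have eb : ((IntermediateField.val _).comp (projSecond fx gx ι))
        (ψ (MonoidAlgebra.of F _ (xa 0))) = ι := hψ.second_b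
    rwa [ea, eb, aeval_algebraMap_apply, aeval_algebraMap_apply] at this
  -- Otherwise ι = -P(-1)/R(-1) would be a square root of -1 in F.
  have r2 : aeval (-1 : F) r = 0 := by
    by_contra hr
    apply hF
    refine ⟨-(aeval (-1 : F) p) / aeval (-1 : F) r, (algebraMap F K).injective ?_⟩
    have hr' : algebraMap F K (aeval (-1 : F) r) ≠ 0 := by simpa using hr
    have : algebraMap F K (-(aeval (-1 : F) p) / aeval (-1 : F) r) = ι := by
      rw [map_div₀, div_eq_iff hr', map_neg]
      linear_combination -s1
    rw [map_mul, this, ← pow_two, hι, map_neg, map_one]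
  have p2 : aeval (-1 : F) p = 0 := by
    rw [r2, map_zero, mul_zero, add_zero] at s1
    simpa using s1
  -- The two polynomials differ by the unit 2.
  have hcop : IsCoprime (X ^ n - 1 : F[X]) (X ^ n + 1) := by
    refine ⟨-C (2⁻¹), C (2⁻¹), ?_⟩
    have : C (2⁻¹ : F) * 2 = 1 := by
      rw [show (2 : F[X]) = C 2 from (C_ofNat 2).symm, ← C_mul, inv_mul_cancel₀ h2, C_1]
    linear_combination this
  have e1 : (X ^ n - 1 : F[X]) = X ^ n - C 1 := by simp
  have e2 : (X - 1 : F[X]) = X - C 1 := by simp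
  have e3 : (X ^ n + 1 : F[X]) = X ^ n - C (-1) := by simp
  have e4 : (X + 1 : F[X]) = X - C (-1) := by simp
  have hdvd : ∀ s : F[X], aeval (1 : F) s = 0 → aeval (-1 : F) s = 0 →
      (∀ i, aeval (fx.selfRoot i) s = 0) →
      (∀ i, aeval (fx.pairRoot i) s = 0 ∧ aeval (fx.pairRoot i)⁻¹ s = 0) →
      (∀ i, aeval (gx.selfRoot i) s = 0) →
      (∀ i, aeval (gx.pairRoot i) s = 0 ∧ aeval (gx.pairRoot i)⁻¹ s = 0) →
      aeval (MonoidAlgebra.of F (QuaternionGroup n) (a 1)) s = 0 := by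
    intro s h1 h2 h3 h4 h5 h6
    obtain ⟨t, rfl⟩ := hcop.mul_dvd (fx.dvd_of_aeval e1 e2 hn0 hn one_ne_zero h1 h3 h4)
      (gx.dvd_of_aeval e3 e4 hn0 hn (neg_ne_zero.2 one_ne_zero) h2 h5 h6)
    have : aeval (MonoidAlgebra.of F (QuaternionGroup n) (a 1))
        ((X ^ n - 1) * (X ^ n + 1) : F[X]) = 0 := by
      have hp : (X ^ n - 1) * (X ^ n + 1) = (X ^ (2 * n) - 1 : F[X]) := by ring
      rw [hp, map_sub, map_pow, aeval_X, map_one, ← map_pow, a_one_pow_n, map_one, sub_self]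
    rw [map_mul, this, zero_mul]
  rw [hdvd p p1 p2 (fun i => (dS i).1.1) (fun i => (dP i).1) (fun i => (qS i).1.1)
      (fun i => (qP i).1),
    hdvd r r1 r2 (fun i => (dS i).2.1) (fun i => (dP i).2) (fun i => (qS i).2.1)
      (fun i => (qP i).2), mul_zero, add_zero]

end SplitHom

/-! ### Dimension count and bijectivity. -/

section Dimension

variable {F K : Type*} [Field F] [Field K] [Algebra F K] {ℓ P ℓ' P' : F[X]} {n : ℕ} {ε : F}

namespace RecipFactorization

theorem finiteDimensional_selfField (fx : RecipFactorization F K ℓ P) (i : Fin fx.numSelf) :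
    FiniteDimensional F (fx.SelfField i) := by
  have hint := isIntegral_of_irreducible (fx.selfFactor_irreducible i) (fx.selfRoot_isRoot i)
  exact IntermediateField.adjoin.finiteDimensional (hint.add hint.inv)

theorem finiteDimensional_pairField (fx : RecipFactorization F K ℓ P) (i : Fin fx.numPair) :
    FiniteDimensional F (fx.PairField i) :=
  IntermediateField.adjoin.finiteDimensional
    (isIntegral_of_irreducible (fx.pairFactor_irreducible i) (fx.pairRoot_isRoot i))

theorem natDegree_selfFactor (fx : RecipFactorization F K ℓ P) (hP : P = X ^ n - C ε)
    (hℓ : ℓ = X - C ε) (hn : Odd n) (hnF : (n : F) ≠ 0) (hε : ε ≠ 0) (i : Fin fx.numSelf) :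
    (fx.selfFactor i).natDegree = 2 * Module.finrank F (fx.SelfField i) :=
  natDegree_eq_two_mul_finrank (fx.selfFactor_irreducible i) (fx.selfFactor_reciprocal i)
    (fx.selfRoot_ne_zero hP hn.pos.ne' hε i) (fx.selfRoot_isRoot i)
    (fx.selfRoot_ne_inv hP hℓ hn hnF hε i)

theorem finiteDimensional_components (fx : RecipFactorization F K ℓ P) :
    FiniteDimensional F (((i : Fin fx.numSelf) → Mat2 (fx.SelfField i)) ×
      ((i : Fin fx.numPair) → Mat2 (fx.PairField i))) := by
  have hs := fx.finiteDimensional_selfField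
  have hp := fx.finiteDimensional_pairField
  have h1 : ∀ i, Module.Finite F (Mat2 (fx.SelfField i)) := fun i => Module.Finite.matrix
  have h2 : ∀ i, Module.Finite F (Mat2 (fx.PairField i)) := fun i => Module.Finite.matrix
  have h3 : Module.Finite F ((i : Fin fx.numSelf) → Mat2 (fx.SelfField i)) := Module.Finite.pi
  have h4 : Module.Finite F ((i : Fin fx.numPair) → Mat2 (fx.PairField i)) := Module.Finite.pi
  exact Module.Finite.prod

/-- Each component has dimension twice the degree of its part of P: 4[E : F] = 2 deg f for
self-reciprocal f, and 4 deg f = 2(deg f + deg f*) for a pair. The leading 2 accounts for ℓ. -/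
theorem finrank_components (fx : RecipFactorization F K ℓ P) (hP : P = X ^ n - C ε)
    (hℓ : ℓ = X - C ε) (hn : Odd n) (hnF : (n : F) ≠ 0) (hε : ε ≠ 0) :
    2 + Module.finrank F (((i : Fin fx.numSelf) → Mat2 (fx.SelfField i)) ×
      ((i : Fin fx.numPair) → Mat2 (fx.PairField i))) = 2 * n := by
  have := fx.finiteDimensional_selfField
  have := fx.finiteDimensional_pairField
  have hdeg := fx.natDegree_sum hP hℓ hn.pos.ne' hε
  rw [Module.finrank_prod, Module.finrank_pi_fintype, Module.finrank_pi_fintype]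
  simp only [Module.finrank_matrix, Fintype.card_fin]
  conv_rhs => rw [hdeg]
  rw [mul_add, mul_add, Finset.mul_sum, Finset.mul_sum, add_assoc]
  congr 2
  · refine Finset.sum_congr rfl fun i _ => ?_
    rw [fx.natDegree_selfFactor hP hℓ hn hnF hε]
    ring
  · refine Finset.sum_congr rfl fun i _ => ?_
    rw [natDegree_eq_finrank (fx.pairFactor_irreducible i) (fx.pairRoot_isRoot i)]
    ring

end RecipFactorization

theorem finrank_prod_prod {V₁ V₂ V₃ V₄ : Type*} [AddCommGroup V₁] [Module F V₁] [AddCommGroup V₂]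
    [Module F V₂] [AddCommGroup V₃] [Module F V₃] [AddCommGroup V₄] [Module F V₄]
    [FiniteDimensional F V₁] [FiniteDimensional F V₂] [FiniteDimensional F V₃]
    [FiniteDimensional F V₄] :
    FiniteDimensional F ((V₁ × V₂) × (V₃ × V₄)) ∧
      Module.finrank F ((V₁ × V₂) × (V₃ × V₄)) = Module.finrank F V₁ + Module.finrank F V₂ +
        (Module.finrank F V₃ + Module.finrank F V₄) := by
  refine ⟨inferInstance, ?_⟩
  rw [Module.finrank_prod, Module.finrank_prod, Module.finrank_prod]

/-- An upper bound suffices, so [F(ι) : F] ≤ 2 is enough here; injectivity of ψ supplies the other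
inequality. -/
theorem finrank_decomp_le (fx : RecipFactorization F K (X - 1) (X ^ n - 1))
    (gx : RecipFactorization F K (X + 1) (X ^ n + 1)) {ι : K} (hι : ι ^ 2 = -1)
    (hn : Odd n) (hnF : (n : F) ≠ 0) :
    FiniteDimensional F (Decomp fx gx ι) ∧ Module.finrank F (Decomp fx gx ι) ≤ 4 * n := by
  have := fx.finiteDimensional_components
  have := gx.finiteDimensional_components
  obtain ⟨hfin, hle⟩ := finrank_adjoin_iota_le (F := F) hι
  have h1 := fx.finrank_components (n := n) (ε := 1) (by simp) (by simp) hn hnF one_ne_zero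
  have h2 := gx.finrank_components (n := n) (ε := -1) (by simp) (by simp) hn hnF
    (neg_ne_zero.2 one_ne_zero)
  obtain ⟨hd, hdim⟩ := finrank_prod_prod (F := F) (V₁ := F × F)
    (V₂ := ((i : Fin fx.numSelf) → Mat2 (fx.SelfField i)) ×
      ((i : Fin fx.numPair) → Mat2 (fx.PairField i))) (V₃ := F⟮ι⟯)
    (V₄ := ((i : Fin gx.numSelf) → Mat2 (gx.SelfField i)) ×
      ((i : Fin gx.numPair) → Mat2 (gx.PairField i)))
  refine ⟨hd, hdim.le.trans ?_⟩
  rw [Module.finrank_prod (M := F), Module.finrank_self]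
  omega

theorem IsSplitHom.bijective [NeZero n] {fx : RecipFactorization F K (X - 1) (X ^ n - 1)}
    {gx : RecipFactorization F K (X + 1) (X ^ n + 1)} {ι : K}
    {ψ : MonoidAlgebra F (QuaternionGroup n) →ₐ[F] Decomp fx gx ι} (hψ : IsSplitHom ψ)
    (hodd : Odd n) (h2 : (2 : F) ≠ 0) (hn : (n : F) ≠ 0) (hι : ι ^ 2 = -1)
    (hF : ¬ IsSquare (-1 : F)) : Function.Bijective ψ := by
  have hinj := hψ.injective h2 hn hι hF
  refine ⟨hinj, ?_⟩
  obtain ⟨hfin, hle⟩ := finrank_decomp_le fx gx hι hodd hn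
  have hcard : Module.finrank F (MonoidAlgebra F (QuaternionGroup n)) = 4 * n := by
    rw [(MonoidAlgebra.coeffLinearEquiv F).finrank_eq, Module.finrank_finsupp_self,
      QuaternionGroup.card]
  have hfin' : FiniteDimensional F (MonoidAlgebra F (QuaternionGroup n)) :=
    FiniteDimensional.of_injective ψ.toLinearMap hinj
  have heq : Module.finrank F (MonoidAlgebra F (QuaternionGroup n)) =
      Module.finrank F (Decomp fx gx ι) :=
    le_antisymm (LinearMap.finrank_le_finrank_of_injective (f := ψ.toLinearMap) hinj)
      (hle.trans hcard.ge)
  exact (LinearMap.injective_iff_surjective_of_finrank_eq_finrank (f := ψ.toLinearMap) heq).1 hinj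

end Dimension

/-! ### Construction of ψ. -/

section Existence

variable {F K : Type*} [Field F] [Fintype F] [Field K] [Algebra F K] {n : ℕ}

/-- This explains the case split: the degree of g_j is 2[E : F], and ι lies in E exactly when [E :
F] is even. -/
theorem iota_mem_selfField_iff (hq : Fintype.card F ≡ 3 [MOD 4]) (hn : Odd n) (hnF : (n : F) ≠ 0)
    (gx : RecipFactorization F K (X + 1) (X ^ n + 1)) {ι : K} (hι : ι ^ 2 = -1)
    (j : Fin gx.numSelf) : ι ∈ gx.SelfField j ↔ 4 ∣ (gx.selfFactor j).natDegree := by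
  have := gx.finiteDimensional_selfField j
  rw [iota_mem_iff_even hq hι, gx.natDegree_selfFactor (n := n) (ε := -1) (by simp) (by simp) hn
    hnF (neg_ne_zero.2 one_ne_zero), even_iff_two_dvd]
  omega

theorem isSplitPair_quatSelf (hq : Fintype.card F ≡ 3 [MOD 4]) (h2 : (2 : F) ≠ 0) (hn : Odd n)
    (hnF : (n : F) ≠ 0) (gx : RecipFactorization F K (X + 1) (X ^ n + 1)) {ι : K}
    (hι : ι ^ 2 = -1) (j : Fin gx.numSelf) (u v : gx.SelfField j)
    (huv : ¬ 4 ∣ (gx.selfFactor j).natDegree → u ^ 2 + v ^ 2 = -1) {A B : Mat2 K}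
    (h1 : 4 ∣ (gx.selfFactor j).natDegree →
      A = gammaMap ι (gx.selfRoot j) !![gx.selfRoot j, 0; 0, (gx.selfRoot j)⁻¹])
    (h1' : 4 ∣ (gx.selfFactor j).natDegree →
      B = gammaMap ι (gx.selfRoot j) !![0, ι; ι, 0])
    (h3 : ¬ 4 ∣ (gx.selfFactor j).natDegree →
      A = thetaMap ι u v !![gx.selfRoot j, 0; 0, (gx.selfRoot j)⁻¹])
    (h3' : ¬ 4 ∣ (gx.selfFactor j).natDegree → B = thetaMap ι u v !![0, ι; ι, 0]) :
    IsSplitPair (gx.selfRoot j) ι ι A B := by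
  have hι0 : ι ≠ 0 := by rintro rfl; simp at hι
  have h2K : (2 : K) ≠ 0 := by
    have := (map_ne_zero (algebraMap F K)).2 h2
    rwa [map_ofNat] at this
  by_cases h4 : 4 ∣ (gx.selfFactor j).natDegree
  · rw [h1 h4, h1' h4]
    exact isSplitPair_gammaMap hι0 (gx.selfRoot_ne_inv (n := n) (ε := -1) (by simp) (by simp) hn
      hnF (neg_ne_zero.2 one_ne_zero) j)
  · rw [h3 h4, h3' h4]
    refine isSplitPair_thetaMap h2K hι ?_ ?_
    · have := congrArg (algebraMap (gx.SelfField j) K) (huv h4)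
      simpa using this
    · intro h
      -- u + ι = 0 would put ι in the field, against 4 ∤ deg g_j.
      rw [← iota_mem_selfField_iff hq hn hnF gx hι j] at h4
      apply h4
      rw [eq_neg_of_add_eq_zero_right h]
      exact neg_mem u.2

theorem exists_quatSelf (hq : Fintype.card F ≡ 3 [MOD 4]) (h2 : (2 : F) ≠ 0) (hn : Odd n)
    (hnF : (n : F) ≠ 0) (gx : RecipFactorization F K (X + 1) (X ^ n + 1)) {ι : K}
    (hι : ι ^ 2 = -1) (j : Fin gx.numSelf) (u v : gx.SelfField j) :
    ∃ A B : Mat2 (gx.SelfField j),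
      ((4 ∣ (gx.selfFactor j).natDegree →
        toK A = gammaMap ι (gx.selfRoot j) !![gx.selfRoot j, 0; 0, (gx.selfRoot j)⁻¹]) ∧
      (4 ∣ (gx.selfFactor j).natDegree →
        toK B = gammaMap ι (gx.selfRoot j) !![0, ι; ι, 0])) ∧
      (¬ 4 ∣ (gx.selfFactor j).natDegree →
        toK A = thetaMap ι u v !![gx.selfRoot j, 0; 0, (gx.selfRoot j)⁻¹]) ∧
      (¬ 4 ∣ (gx.selfFactor j).natDegree → toK B = thetaMap ι u v !![0, ι; ι, 0]) := by
  have hι0 : ι ≠ 0 := by rintro rfl; simp at hι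
  have h2K : (2 : K) ≠ 0 := by
    have := (map_ne_zero (algebraMap F K)).2 h2
    rwa [map_ofNat] at this
  have hm1 : (-1 : F) ≠ 0 := neg_ne_zero.2 one_ne_zero
  have h0 := gx.selfRoot_ne_zero (n := n) (ε := -1) (by simp) hn.pos.ne' hm1 j
  have h1 := gx.selfRoot_ne_inv (n := n) (ε := -1) (by simp) (by simp) hn hnF hm1 j
  have := gx.finiteDimensional_selfField j
  by_cases h4 : 4 ∣ (gx.selfFactor j).natDegree
  · obtain ⟨A, B, hA, hB⟩ := exists_gammaMap hι h0 h1
      ((iota_mem_selfField_iff hq hn hnF gx hι j).2 h4)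
    exact ⟨A, B, ⟨fun _ => hA, fun _ => hB⟩, fun h => absurd h4 h, fun h => absurd h4 h⟩
  · have hnot := not_mem_adjoin_add_inv (gx.selfFactor_irreducible j)
      (gx.selfFactor_reciprocal j) h0 (gx.selfRoot_isRoot j) h1
    have hodd : ¬ Even (Module.finrank F (gx.SelfField j)) := by
      rwa [← iota_mem_iff_even hq hι, iota_mem_selfField_iff hq hn hnF gx hι j]
    obtain ⟨A, B, hA, hB⟩ := exists_thetaMap h2K hι0 u v
      (sub_inv_div_mem hq h2K hι h0 (gx.SelfField j)
        (IntermediateField.mem_adjoin_simple_self F _) hnot hodd)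
    exact ⟨A, B, ⟨fun h => absurd h h4, fun h => absurd h h4⟩, fun _ => hA, fun _ => hB⟩

theorem exists_isStandardIso (hn : Odd n) (h2 : (2 : F) ≠ 0) (hnF : (n : F) ≠ 0)
    (hq : Fintype.card F ≡ 3 [MOD 4])
    (fx : RecipFactorization F K (X - 1) (X ^ n - 1))
    (gx : RecipFactorization F K (X + 1) (X ^ n + 1))
    (ι : K) (hι : ι ^ 2 = -1)
    (u v : (j : Fin gx.numSelf) → gx.SelfField j)
    (huv : ∀ j, ¬ 4 ∣ (gx.selfFactor j).natDegree → u j ^ 2 + v j ^ 2 = -1) :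
    ∃ ψ : MonoidAlgebra F (QuaternionGroup n) ≃ₐ[F] Decomp fx gx ι,
      IsStandardIso fx gx ι u v ψ := by
  have : NeZero n := ⟨hn.pos.ne'⟩
  have hF : ¬ IsSquare (-1 : F) := by
    rw [FiniteField.isSquare_neg_one_iff, not_not]
    exact hq
  have hm1 : (-1 : F) ≠ 0 := neg_ne_zero.2 one_ne_zero
  have hfP : (X ^ n - 1 : F[X]) = X ^ n - C 1 := by simp
  have hfℓ : (X - 1 : F[X]) = X - C 1 := by simp
  have hgP : (X ^ n + 1 : F[X]) = X ^ n - C (-1) := by simp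
  have hgℓ : (X + 1 : F[X]) = X - C (-1) := by simp
  have fs0 := fx.selfRoot_ne_zero hfP hn.pos.ne' one_ne_zero
  have fs1 := fx.selfRoot_ne_inv hfP hfℓ hn hnF one_ne_zero
  have fp0 := fx.pairRoot_ne_zero hfP hn.pos.ne' one_ne_zero
  have gs0 := gx.selfRoot_ne_zero hgP hn.pos.ne' hm1
  have gp0 := gx.pairRoot_ne_zero hgP hn.pos.ne' hm1
  have fsn := fx.selfRoot_pow hfP
  have fpn := fx.pairRoot_pow hfP
  have gsn := gx.selfRoot_pow hgP
  have gpn := gx.pairRoot_pow hgP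
  rw [map_one] at fsn fpn
  rw [map_neg, map_one] at gsn gpn
  choose A₁ B₁ hA₁ hB₁ using fun i => exists_sigmaMap (F := F) (fs0 i) (fs1 i)
  choose A₂ B₂ hA₂ hB₂ using fun i => exists_diag (F := F) (β := fx.pairRoot i) 1 1
  choose A₃ B₃ hγ hθ using fun j => exists_quatSelf hq h2 hn hnF gx hι j (u j) (v j)
  choose A₄ B₄ hA₄ hB₄ using fun j => exists_diag (F := F) (β := gx.pairRoot j) (-1) 1
  simp only [map_neg, map_one] at hB₂ hB₄
  have s₁ : ∀ i, IsSplitPair (fx.selfRoot i) 1 1 (toK (A₁ i)) (toK (B₁ i)) := fun i => by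
    rw [hA₁, hB₁]; exact isSplitPair_sigmaMap (fs1 i)
  have s₂ : ∀ i, IsSplitPair (fx.pairRoot i) 1 1 (toK (A₂ i)) (toK (B₂ i)) := fun i => by
    rw [hA₂, hB₂]; exact isSplitPair_self _ _ _
  have s₃ : ∀ j, IsSplitPair (gx.selfRoot j) ι ι (toK (A₃ j)) (toK (B₃ j)) := fun j =>
    isSplitPair_quatSelf hq h2 hn hnF gx hι j (u j) (v j) (huv j) (hγ j).1 (hγ j).2
      (hθ j).1 (hθ j).2
  have s₄ : ∀ j, IsSplitPair (gx.pairRoot j) (-1) 1 (toK (A₄ j)) (toK (B₄ j)) := fun j => by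
    rw [hA₄, hB₄]; exact isSplitPair_self _ _ _
  have r₁ := fun i => relations_of_isSplitPair (s₁ i) (fs0 i) (fsn i) (one_mul 1) (one_pow 2)
  have r₂ := fun i => relations_of_isSplitPair (s₂ i) (fp0 i) (fpn i) (one_mul 1) (one_pow 2)
  have r₃ := fun j => relations_of_isSplitPair (s₃ j) (gs0 j) (gsn j) (by rw [← pow_two, hι])
    (by ring)
  have r₄ := fun j => relations_of_isSplitPair (s₄ j) (gp0 j) (gpn j) (by ring) (by ring)
  let i₀ : F⟮ι⟯ := IntermediateField.AdjoinSimple.gen F ι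
  have hi₀ : i₀ ^ 2 = -1 := Subtype.ext hι
  let a₀ : Decomp fx gx ι := (((1, 1), A₁, A₂), (-1, A₃, A₄))
  let b₀ : Decomp fx gx ι := (((1, -1), B₁, B₂), (i₀, B₃, B₄))
  have ha : a₀ ^ (2 * n) = 1 := by
    refine Prod.ext (Prod.ext ?_ (Prod.ext (funext fun i => (r₁ i).1) (funext fun i => (r₂ i).1)))
      (Prod.ext ?_ (Prod.ext (funext fun i => (r₃ i).1) (funext fun i => (r₄ i).1)))
    · exact Prod.ext (one_pow _) (one_pow _)
    · change (-1 : F⟮ι⟯) ^ (2 * n) = 1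
      rw [pow_mul]
      simp
  have hb : b₀ ^ 2 = a₀ ^ n := by
    refine Prod.ext (Prod.ext ?_ (Prod.ext (funext fun i => (r₁ i).2.1)
        (funext fun i => (r₂ i).2.1)))
      (Prod.ext ?_ (Prod.ext (funext fun i => (r₃ i).2.1) (funext fun i => (r₄ i).2.1)))
    · refine Prod.ext ?_ ?_
      · change (1 : F) ^ 2 = 1 ^ n
        simp
      · change (-1 : F) ^ 2 = 1 ^ n
        simp
    · change i₀ ^ 2 = (-1) ^ n
      rw [hi₀, hn.neg_one_pow]
  have hab : a₀ * b₀ * a₀ = b₀ := by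
    refine Prod.ext (Prod.ext ?_ (Prod.ext (funext fun i => (r₁ i).2.2)
        (funext fun i => (r₂ i).2.2)))
      (Prod.ext ?_ (Prod.ext (funext fun i => (r₃ i).2.2) (funext fun i => (r₄ i).2.2)))
    · refine Prod.ext ?_ ?_
      · change (1 : F) * 1 * 1 = 1
        simp
      · change (1 : F) * -1 * 1 = -1
        simp
    · change -1 * i₀ * -1 = i₀
      ring
  let ψ₀ : MonoidAlgebra F (QuaternionGroup n) →ₐ[F] Decomp fx gx ι :=
    quaternionRep a₀ b₀ ha hb hab
  have hψa : ψ₀ (MonoidAlgebra.of F _ (a 1)) = a₀ := quaternionRep_a _ _ _ _ _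
  have hψb : ψ₀ (MonoidAlgebra.of F _ (xa 0)) = b₀ := quaternionRep_b _ _ _ _ _
  have hsplit : IsSplitHom ψ₀ := by
    constructor <;> simp only [hψa, hψb]
    · rfl
    · rfl
    · exact s₁
    · exact s₂
    · rfl
    · rfl
    · exact s₃
    · exact s₄
  refine ⟨AlgEquiv.ofBijective ψ₀ (hsplit.bijective hn h2 hnF hι hF), ?_⟩
  constructor <;> simp only [AlgEquiv.coe_ofBijective, hψa, hψb]
  · rfl
  · rfl
  · exact hA₁
  · exact hB₁
  · exact hA₂
  · exact hB₂
  · rfl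
  · rfl
  · exact fun j => (hγ j).1
  · exact fun j => (hγ j).2
  · exact fun j => (hθ j).1
  · exact fun j => (hθ j).2
  · exact hA₄
  · exact hB₄

end Existence

/-! ### Left ideals of products, and duality on the commutative components. -/

section Ideals

theorem span_prodMk {R S : Type*} [Ring R] [Ring S] (x : R × S) :
    Ideal.span {x} = Ideal.prod (Ideal.span {x.1}) (Ideal.span {x.2}) := by
  ext y
  rw [Ideal.mem_prod, Ideal.mem_span_singleton', Ideal.mem_span_singleton',
    Ideal.mem_span_singleton']
  constructor
  · rintro ⟨z, rfl⟩
    exact ⟨⟨z.1, rfl⟩, ⟨z.2, rfl⟩⟩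
  · rintro ⟨⟨z₁, h₁⟩, ⟨z₂, h₂⟩⟩
    exact ⟨(z₁, z₂), Prod.ext h₁ h₂⟩

/-- Left multiplication by the idempotents `Pi.single i 1` cuts an element of J into coordinates
that stay in J; the finite sum restores it. -/
theorem exists_eq_pi {I : Type*} [Fintype I] {R : I → Type*} [∀ i, Ring (R i)]
    (J : Ideal (∀ i, R i)) : ∃ L : ∀ i, Ideal (R i), J = Ideal.pi L := by
  classical
  let L : ∀ i, Ideal (R i) := fun i =>
    { carrier := {r | Pi.single i r ∈ J}
      zero_mem' := by simp
      add_mem' := fun {x y} hx hy => by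
        rw [Set.mem_ofPred_eq, Pi.single_add]
        exact J.add_mem hx hy
      smul_mem' := fun c x hx => by
        rw [Set.mem_ofPred_eq, smul_eq_mul, Pi.single_mul]
        exact J.mul_mem_left _ hx }
  refine ⟨L, le_antisymm ?_ ?_⟩
  · intro x hx
    rw [Ideal.mem_pi]
    intro i
    change Pi.single i (x i) ∈ J
    have : Pi.single i (x i) = Pi.single i 1 * x := by
      rw [← Pi.single_mul_left, one_mul]
    rw [this]
    exact J.mul_mem_left _ hx
  · intro x hx
    rw [Ideal.mem_pi] at hx
    rw [← Finset.univ_sum_single x]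
    exact J.sum_mem fun i _ => hx i

theorem exists_eq_prod {R S : Type*} [Ring R] [Ring S] (J : Ideal (R × S)) :
    ∃ (L : Ideal R) (M : Ideal S), J = Ideal.prod L M :=
  ⟨_, _, Ideal.ideal_prod_eq J⟩

theorem exists_isReducedRowEchelon_span_field {E : Type*} [Field E] (J : Ideal E) :
    ∃ e : E, (!![e] : Matrix (Fin 1) (Fin 1) E).IsReducedRowEchelon ∧ J = Ideal.span {e} := by
  have key : ∀ e : E, e = 0 ∨ e = 1 →
      (!![e] : Matrix (Fin 1) (Fin 1) E).IsReducedRowEchelon := by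
    intro e he
    refine ⟨fun i j hij => absurd hij (by simp), fun i c hc => ?_,
      fun i j c hij => absurd hij (by simp)⟩
    have h2 := hc.2
    rw [Subsingleton.elim i 0, Subsingleton.elim c 0] at h2 ⊢
    simp only [Matrix.of_apply, Matrix.cons_val_fin_one] at h2 ⊢
    exact he.resolve_left h2
  rcases Ideal.eq_bot_or_top J with rfl | rfl
  · exact ⟨0, key 0 (Or.inl rfl), by simp⟩
  · exact ⟨1, key 1 (Or.inr rfl), by simp⟩

theorem mul_eq_zero_iff_mem_dualFirst {E : Type*} [Field E] (m y : E × E) :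
    y * m = 0 ↔ y ∈ dualFirst (Ideal.span {m}) := by
  obtain ⟨m₁, m₂⟩ := m
  obtain ⟨y₁, y₂⟩ := y
  have htop : ∀ e : E, e ≠ 0 → Ideal.span {e} = (⊤ : Ideal E) := fun e he =>
    Ideal.span_singleton_eq_top.2 (isUnit_iff_ne_zero.2 he)
  rw [span_prodMk, dualFirst, Prod.ext_iff]
  simp only [Ideal.prod_inj]
  by_cases h₁ : m₁ = 0 <;> by_cases h₂ : m₂ = 0 <;> simp [h₁, h₂, htop]

/-- A field homomorphism is injective, so the twist by `f` does not change the annihilator. -/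
theorem mul_eq_zero_iff_mem_dualQuat_field {E : Type*} [Field E] (f : E →+* E) (m y : E) :
    y * f m = 0 ↔ y ∈ dualQuat (Ideal.span {m}) := by
  by_cases h : m = 0
  · simp [h, dualQuat]
  · have : Ideal.span {m} = (⊤ : Ideal E) :=
      Ideal.span_singleton_eq_top.2 (isUnit_iff_ne_zero.2 h)
    simp [this, dualQuat, h]

end Ideals

/-! ### Reduction of ideals and products to components. -/

section Decomposition

variable {F K : Type*} [Field F] [Field K] [Algebra F K] {ℓ P ℓ' P' : F[X]}
  {fx : RecipFactorization F K ℓ P} {gx : RecipFactorization F K ℓ' P'} {ι : K}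

theorem tupleIdeal_eq_span (m : Decomp fx gx ι) : tupleIdeal m = Ideal.span {m} := by
  rw [tupleIdeal, span_prodMk m, span_prodMk m.1, span_prodMk m.2, span_prodMk m.1.2,
    span_prodMk m.2.2, ← Ideal.pi_span (r := m.1.2.1),
    ← Ideal.pi_span (r := m.1.2.2), ← Ideal.pi_span (r := m.2.2.1),
    ← Ideal.pi_span (r := m.2.2.2)]

theorem exists_isReducedTuple (J : Ideal (Decomp fx gx ι)) :
    ∃ m : Decomp fx gx ι, IsReducedTuple m ∧ J = tupleIdeal m := by
  obtain ⟨J₁, J₂, rfl⟩ := exists_eq_prod J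
  obtain ⟨J₁, J₃, rfl⟩ := exists_eq_prod J₁
  obtain ⟨J₂, J₄, rfl⟩ := exists_eq_prod J₂
  obtain ⟨J₁, J₁', rfl⟩ := exists_eq_prod J₁
  obtain ⟨J₃, J₃', rfl⟩ := exists_eq_prod J₃
  obtain ⟨J₄, J₄', rfl⟩ := exists_eq_prod J₄
  obtain ⟨L₃, rfl⟩ := exists_eq_pi J₃
  obtain ⟨L₃', rfl⟩ := exists_eq_pi J₃'
  obtain ⟨L₄, rfl⟩ := exists_eq_pi J₄
  obtain ⟨L₄', rfl⟩ := exists_eq_pi J₄'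
  obtain ⟨e₁, h₁, rfl⟩ := exists_isReducedRowEchelon_span_field J₁
  obtain ⟨e₁', h₁', rfl⟩ := exists_isReducedRowEchelon_span_field J₁'
  obtain ⟨e₂, h₂, rfl⟩ := exists_isReducedRowEchelon_span_field J₂
  choose m₃ h₃ e₃ using fun i => exists_isReducedRowEchelon_span (L₃ i)
  choose m₃' h₃' e₃' using fun i => exists_isReducedRowEchelon_span (L₃' i)
  choose m₄ h₄ e₄ using fun i => exists_isReducedRowEchelon_span (L₄ i)
  choose m₄' h₄' e₄' using fun i => exists_isReducedRowEchelon_span (L₄' i)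
  obtain rfl := funext e₃
  obtain rfl := funext e₃'
  obtain rfl := funext e₄
  obtain rfl := funext e₄'
  refine ⟨(((e₁, e₁'), m₃, m₃'), (e₂, m₄, m₄')), ⟨h₁, h₁', h₃, h₃', h₂, h₄, h₄'⟩, ?_⟩
  rw [tupleIdeal, span_prodMk (e₁, e₁')]

theorem mul_eq_zero_iff_components (y z : Decomp fx gx ι) :
    y * z = 0 ↔ (y.1.1 * z.1.1 = 0 ∧ (∀ i, y.1.2.1 i * z.1.2.1 i = 0) ∧
      ∀ i, y.1.2.2 i * z.1.2.2 i = 0) ∧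
      y.2.1 * z.2.1 = 0 ∧ (∀ i, y.2.2.1 i * z.2.2.1 i = 0) ∧
      ∀ i, y.2.2.2 i * z.2.2.2 i = 0 := by
  constructor
  · intro h
    refine ⟨⟨congrArg (fun w => w.1.1) h, fun i => congrArg (fun w => w.1.2.1 i) h,
      fun i => congrArg (fun w => w.1.2.2 i) h⟩, congrArg (fun w => w.2.1) h,
      fun i => congrArg (fun w => w.2.2.1 i) h, fun i => congrArg (fun w => w.2.2.2 i) h⟩
  · rintro ⟨⟨h₁, h₂, h₃⟩, h₄, h₅, h₆⟩
    exact Prod.ext (Prod.ext h₁ (Prod.ext (funext h₂) (funext h₃)))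
      (Prod.ext h₄ (Prod.ext (funext h₅) (funext h₆)))

theorem mem_dualTupleIdeal_iff (m y : Decomp fx gx ι) :
    y ∈ dualTupleIdeal m ↔ (y.1.1 ∈ dualFirst (Ideal.span {m.1.1}) ∧
      (∀ i, y.1.2.1 i ∈ Ideal.span {dualDihSelf (IntermediateField.AdjoinSimple.gen F
        (fx.selfRoot i + (fx.selfRoot i)⁻¹)) (m.1.2.1 i)}) ∧
      ∀ i, y.1.2.2 i ∈ Ideal.span {dualDihPair (m.1.2.2 i)}) ∧
      y.2.1 ∈ dualQuat (Ideal.span {m.2.1}) ∧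
      (∀ i, y.2.2.1 i ∈ dualQuat (Ideal.span {m.2.2.1 i})) ∧
      ∀ i, y.2.2.2 i ∈ dualQuat (Ideal.span {m.2.2.2 i}) := by
  simp only [dualTupleIdeal, Ideal.mem_prod, Ideal.mem_pi]

end Decomposition

/-! ### Invariant forms on the components and the dual code. -/

section Duality

variable {F K : Type*} [Field F] [Field K] [Algebra F K]

theorem transpose_mul_mul_eq_det_smul {E : Type*} [Field E] (A : Mat2 E) (h : A.det = 1) :
    A.transpose * !![0, 1; -1, 0] * A = !![0, 1; -1, 0] := by
  rw [Matrix.det_fin_two] at h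
  ext i j
  fin_cases i <;> fin_cases j <;> simp [Matrix.mul_apply, Fin.sum_univ_two]
  · ring
  · linear_combination h
  · linear_combination -h
  · ring

theorem det_eq_one_of_toK {E : IntermediateField F K} {A : Mat2 E} (h : (toK A).det = 1) :
    A.det = 1 := by
  apply (algebraMap E K).injective
  rw [RingHom.map_det, map_one]
  exact h

/-- Both generators have determinant 1, and a 2 × 2 matrix scales the alternating form by its
determinant. -/
theorem IsSplitPair.transpose_mul_mul {E : IntermediateField F K} {A B : Mat2 E} {β c d : K}
    (h : IsSplitPair β c d (toK A) (toK B)) (hβ : β ≠ 0) (hcd : c * d = -1) :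
    A.transpose * !![0, 1; -1, 0] * A = !![0, 1; -1, 0] ∧
      B.transpose * !![0, 1; -1, 0] * B = !![0, 1; -1, 0] :=
  ⟨transpose_mul_mul_eq_det_smul A (det_eq_one_of_toK (h.det_left hβ)),
    transpose_mul_mul_eq_det_smul B (det_eq_one_of_toK (by rw [h.det_right, hcd, neg_neg]))⟩

/-- For s = α + α⁻¹ the form [2, -s; -s, 2] is Zᵀ [0, 1; 1, 0] Z with Z = [1, -α; 1, -α⁻¹]: the
hyperbolic form of the pair components transported by σ. -/
theorem transpose_mul_mul_of_companion {E : Type*} [Field E] (s : E) :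
    (!![0, 1; -1, s] : Mat2 E).transpose * !![2, -s; -s, 2] * !![0, 1; -1, s] =
        !![2, -s; -s, 2] ∧
      (!![1, -s; 0, -1] : Mat2 E).transpose * !![2, -s; -s, 2] * !![1, -s; 0, -1] =
        !![2, -s; -s, 2] := by
  constructor <;> ext i j <;> fin_cases i <;> fin_cases j <;>
    simp [Matrix.mul_apply, Fin.sum_univ_two] <;> ring

theorem transpose_mul_mul_of_sigmaMap {α : K} (h0 : α ≠ 0) (h1 : α ≠ α⁻¹)
    {A B : Mat2 F⟮α + α⁻¹⟯} (hA : toK A = sigmaMap α !![α, 0; 0, α⁻¹])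
    (hB : toK B = sigmaMap α !![0, 1; 1, 0]) {s : F⟮α + α⁻¹⟯}
    (hs : s = IntermediateField.AdjoinSimple.gen F (α + α⁻¹)) :
    A.transpose * !![2, -s; -s, 2] * A = !![2, -s; -s, 2] ∧
      B.transpose * !![2, -s; -s, 2] * B = !![2, -s; -s, 2] := by
  have hs' : (s : K) = α + α⁻¹ := by rw [hs]; rfl
  have eA : A = !![0, 1; -1, s] := by
    apply toK_injective
    rw [hA, sigmaMap_diag h0 h1, toK_of]
    simp [hs']
  have eB : B = !![1, -s; 0, -1] := by
    apply toK_injective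
    rw [hB, sigmaMap_swap h1, toK_of]
    simp [hs']
  rw [eA, eB]
  exact transpose_mul_mul_of_companion s

theorem transpose_mul_mul_of_diag {E : IntermediateField F K} {β : K} (h0 : β ≠ 0) {A B : Mat2 E}
    (hA : toK A = !![β, 0; 0, β⁻¹]) (hB : toK B = !![0, 1; 1, 0]) :
    A.transpose * !![0, 1; 1, 0] * A = !![0, 1; 1, 0] ∧
      B.transpose * !![0, 1; 1, 0] * B = !![0, 1; 1, 0] := by
  have hP : toK (!![0, 1; 1, 0] : Mat2 E) = !![0, 1; 1, 0] := by rw [toK_of]; simp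
  have ht : ∀ X : Mat2 E, toK X.transpose = (toK X).transpose := fun X => Matrix.transpose_map.symm
  constructor <;> apply toK_injective
  · rw [← toKHom_apply, map_mul, map_mul, toKHom_apply, toKHom_apply, toKHom_apply, ht, hP, hA]
    ext i j
    fin_cases i <;> fin_cases j <;> simp [Matrix.mul_apply, Fin.sum_univ_two, h0]
  · rw [← toKHom_apply, map_mul, map_mul, toKHom_apply, toKHom_apply, toKHom_apply, ht, hP, hB]
    ext i j
    fin_cases i <;> fin_cases j <;> simp [Matrix.mul_apply, Fin.sum_univ_two]

/-- Nondegeneracy of the form above: its determinant is -(α - α⁻¹)². -/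
theorem four_sub_sq_ne_zero {α : K} (h0 : α ≠ 0) (h1 : α ≠ α⁻¹) :
    4 - IntermediateField.AdjoinSimple.gen F (α + α⁻¹) ^ 2 ≠ 0 := by
  intro h
  have := congrArg (algebraMap F⟮α + α⁻¹⟯ K) h
  rw [map_sub, map_pow, map_ofNat, map_zero, IntermediateField.AdjoinSimple.algebraMap_gen] at this
  apply h1
  have h2 : (α - α⁻¹) ^ 2 = 0 := by
    have : (α - α⁻¹) ^ 2 = -(4 - (α + α⁻¹) ^ 2) := by field_simp; ring
    rw [this]
    simp [*]
  exact sub_eq_zero.1 (pow_eq_zero_iff two_ne_zero |>.1 h2)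

variable {n : ℕ} {fx : RecipFactorization F K (X - 1) (X ^ n - 1)}
  {gx : RecipFactorization F K (X + 1) (X ^ n + 1)} {ι : K}
  {u v : (j : Fin gx.numSelf) → gx.SelfField j}
  {ψ : MonoidAlgebra F (QuaternionGroup n) ≃ₐ[F] Decomp fx gx ι}

theorem IsStandardIso.first_invMap [NeZero n] (hψ : IsStandardIso fx gx ι u v ψ)
    (x : MonoidAlgebra F (QuaternionGroup n)) : (ψ (invMap x)).1.1 = (ψ x).1.1 := by
  refine map_invMap_eq_of_comm ((projFirst fx gx ι).comp (ψ : _ →ₐ[F] _)) (AlgHom.id F _)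
    ?_ ?_ x
  · change (ψ (MonoidAlgebra.of F _ (a 1))).1.1 * (ψ (MonoidAlgebra.of F _ (a 1))).1.1 = 1
    rw [hψ.first_a]
    ext <;> simp
  · change (ψ (MonoidAlgebra.of F _ (xa 0))).1.1 * (ψ (MonoidAlgebra.of F _ (xa 0))).1.1 = 1
    rw [hψ.first_b]
    ext <;> simp

theorem IsStandardIso.second_invMap [Fintype F] [NeZero n] (hψ : IsStandardIso fx gx ι u v ψ)
    (hq : Fintype.card F ≡ 3 [MOD 4]) (hι : ι ^ 2 = -1)
    (x : MonoidAlgebra F (QuaternionGroup n)) :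
    (ψ (invMap x)).2.1 = FiniteField.frobeniusAlgHom F F⟮ι⟯ (ψ x).2.1 := by
  refine map_invMap_eq_of_comm ((projSecond fx gx ι).comp (ψ : _ →ₐ[F] _))
    (FiniteField.frobeniusAlgHom F F⟮ι⟯) ?_ ?_ x
  · change FiniteField.frobeniusAlgHom F F⟮ι⟯ (ψ (MonoidAlgebra.of F _ (a 1))).2.1 *
      (ψ (MonoidAlgebra.of F _ (a 1))).2.1 = 1
    rw [hψ.second_a, map_neg, map_one]
    ring
  · change (ψ (MonoidAlgebra.of F _ (xa 0))).2.1 ^ Fintype.card F *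
      (ψ (MonoidAlgebra.of F _ (xa 0))).2.1 = 1
    -- Frobenius inverts ι because ι⁴ = 1 and 4 divides q + 1.
    obtain ⟨k, hk⟩ : ∃ k, Fintype.card F + 1 = 4 * k := by
      have : Fintype.card F % 4 = 3 := hq
      exact ⟨(Fintype.card F + 1) / 4, by omega⟩
    have hi : (ψ (MonoidAlgebra.of F _ (xa 0))).2.1 ^ 2 = -1 := by
      apply Subtype.ext
      rw [SubmonoidClass.coe_pow, hψ.second_b, hι]
      rfl
    rw [← pow_succ, hk, show 4 * k = 2 * (2 * k) by ring, pow_mul, hi, pow_mul, neg_one_sq,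
      one_pow]

theorem IsStandardIso.dihSelf_invMap [NeZero n] (hψ : IsStandardIso fx gx ι u v ψ)
    (i : Fin fx.numSelf) (h0 : fx.selfRoot i ≠ 0) (h1 : fx.selfRoot i ≠ (fx.selfRoot i)⁻¹)
    {s : fx.SelfField i}
    (hs : s = IntermediateField.AdjoinSimple.gen F (fx.selfRoot i + (fx.selfRoot i)⁻¹))
    (x : MonoidAlgebra F (QuaternionGroup n)) :
    !![2, -s; -s, 2] * (ψ (invMap x)).1.2.1 i =
      ((ψ x).1.2.1 i).transpose * !![2, -s; -s, 2] := by
  obtain ⟨hA, hB⟩ := transpose_mul_mul_of_sigmaMap h0 h1 (hψ.dihSelf_a i) (hψ.dihSelf_b i) hs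
  have key : ∀ z, (projDihSelf fx gx ι i).comp (ψ : _ →ₐ[F] _) z = (ψ z).1.2.1 i := fun _ => rfl
  rw [← key] at hA hB
  rw [← key, ← key]
  exact mul_map_invMap_eq_transpose_mul _ _ hA hB x

theorem IsStandardIso.dihPair_invMap [NeZero n] (hψ : IsStandardIso fx gx ι u v ψ)
    (i : Fin fx.numPair) (h0 : fx.pairRoot i ≠ 0) (x : MonoidAlgebra F (QuaternionGroup n)) :
    !![0, 1; 1, 0] * (ψ (invMap x)).1.2.2 i = ((ψ x).1.2.2 i).transpose * !![0, 1; 1, 0] := by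
  obtain ⟨hA, hB⟩ := transpose_mul_mul_of_diag h0 (hψ.dihPair_a i) (hψ.dihPair_b i)
  have key : ∀ z, (projDihPair fx gx ι i).comp (ψ : _ →ₐ[F] _) z = (ψ z).1.2.2 i := fun _ => rfl
  rw [← key] at hA hB
  rw [← key, ← key]
  exact mul_map_invMap_eq_transpose_mul _ _ hA hB x

/-- Only the split pair enters, so the γ and θ cases are treated at once. -/
theorem quatSelf_invMap [NeZero n] (j : Fin gx.numSelf) (h0 : gx.selfRoot j ≠ 0)
    (hι : ι ^ 2 = -1) (h : IsSplitPair (gx.selfRoot j) ι ι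
      (toK ((ψ (MonoidAlgebra.of F _ (a 1))).2.2.1 j))
      (toK ((ψ (MonoidAlgebra.of F _ (xa 0))).2.2.1 j)))
    (x : MonoidAlgebra F (QuaternionGroup n)) :
    !![0, 1; -1, 0] * (ψ (invMap x)).2.2.1 j =
      ((ψ x).2.2.1 j).transpose * !![0, 1; -1, 0] := by
  obtain ⟨hA, hB⟩ := h.transpose_mul_mul h0 (by rw [← pow_two, hι])
  have key : ∀ z, (projQuatSelf fx gx ι j).comp (ψ : _ →ₐ[F] _) z = (ψ z).2.2.1 j := fun _ => rfl
  rw [← key] at hA hB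
  rw [← key, ← key]
  exact mul_map_invMap_eq_transpose_mul _ _ hA hB x

theorem IsStandardIso.quatPair_invMap [NeZero n] (hψ : IsStandardIso fx gx ι u v ψ)
    (j : Fin gx.numPair) (h0 : gx.pairRoot j ≠ 0) (x : MonoidAlgebra F (QuaternionGroup n)) :
    !![0, 1; -1, 0] * (ψ (invMap x)).2.2.2 j =
      ((ψ x).2.2.2 j).transpose * !![0, 1; -1, 0] := by
  have h : IsSplitPair (gx.pairRoot j) (-1) 1
      (toK ((ψ (MonoidAlgebra.of F _ (a 1))).2.2.2 j))
      (toK ((ψ (MonoidAlgebra.of F _ (xa 0))).2.2.2 j)) := by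
    rw [hψ.quatPair_a, hψ.quatPair_b]
    exact isSplitPair_self _ _ _
  obtain ⟨hA, hB⟩ := h.transpose_mul_mul h0 (by ring)
  have key : ∀ z, (projQuatPair fx gx ι j).comp (ψ : _ →ₐ[F] _) z = (ψ z).2.2.2 j := fun _ => rfl
  rw [← key] at hA hB
  rw [← key, ← key]
  exact mul_map_invMap_eq_transpose_mul _ _ hA hB x

theorem image_euclideanDual_eq [Fintype F] (hn : Odd n) (h2 : (2 : F) ≠ 0)
    (hnF : (n : F) ≠ 0) (hq : Fintype.card F ≡ 3 [MOD 4]) (hι : ι ^ 2 = -1)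
    (huv : ∀ j, ¬ 4 ∣ (gx.selfFactor j).natDegree → u j ^ 2 + v j ^ 2 = -1)
    (hψ : IsStandardIso fx gx ι u v ψ)
    {C : Submodule F (Fin (4 * n) → F)} {φ : Fin (4 * n) ≃ QuaternionGroup n}
    (hC : IsGroupCodeVia φ C) {m : Decomp fx gx ι} (hm : IsReducedTuple m)
    (h : ψ '' groupAlgebraSet φ C = (tupleIdeal m : Set (Decomp fx gx ι))) :
    ψ '' groupAlgebraSet φ (euclideanDual C) = (dualTupleIdeal m : Set (Decomp fx gx ι)) := by
  have : NeZero n := ⟨hn.pos.ne'⟩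
  have hm1 : (-1 : F) ≠ 0 := neg_ne_zero.2 one_ne_zero
  have hfP : (X ^ n - 1 : F[X]) = X ^ n - Polynomial.C 1 := by simp
  have hfℓ : (X - 1 : F[X]) = X - Polynomial.C 1 := by simp
  have hgP : (X ^ n + 1 : F[X]) = X ^ n - Polynomial.C (-1) := by simp
  have fs0 := fx.selfRoot_ne_zero hfP hn.pos.ne' one_ne_zero
  have fs1 := fx.selfRoot_ne_inv hfP hfℓ hn hnF one_ne_zero
  have fp0 := fx.pairRoot_ne_zero hfP hn.pos.ne' one_ne_zero
  have gs0 := gx.selfRoot_ne_zero hgP hn.pos.ne' hm1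
  have gp0 := gx.pairRoot_ne_zero hgP hn.pos.ne' hm1
  rw [tupleIdeal_eq_span] at h
  obtain ⟨x, rfl⟩ := ψ.surjective m
  ext y
  rw [mem_image_euclideanDual_iff φ C hC ψ _ h, SetLike.mem_coe, mul_eq_zero_iff_components,
    mem_dualTupleIdeal_iff, ψ.symm_apply_apply, hψ.first_invMap, hψ.second_invMap hq hι]
  refine and_congr (and_congr (mul_eq_zero_iff_mem_dualFirst _ _) (and_congr
    (forall_congr' fun i => ?_) (forall_congr' fun i => ?_)))
    (and_congr (mul_eq_zero_iff_mem_dualQuat_field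
      (FiniteField.frobeniusAlgHom F F⟮ι⟯ : F⟮ι⟯ →+* F⟮ι⟯) _ _)
      (and_congr (forall_congr' fun i => ?_) (forall_congr' fun i => ?_)))
  · refine mul_eq_zero_iff_mem_dualDihSelf ?_ (four_sub_sq_ne_zero (fs0 i) (fs1 i)) (hm.dihSelf i)
      (hψ.dihSelf_invMap i (fs0 i) (fs1 i) rfl x) _
    have := (map_ne_zero (algebraMap F (fx.SelfField i))).2 h2
    rwa [map_ofNat] at this
  · exact mul_eq_zero_iff_mem_dualDihPair (hm.dihPair i) (hψ.dihPair_invMap i (fp0 i) x) _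
  · exact mul_eq_zero_iff_mem_dualQuat (hm.quatSelf i) (quatSelf_invMap i (gs0 i) hι
      (isSplitPair_quatSelf hq h2 hn hnF gx hι i (u i) (v i) (huv i) (hψ.gamma_a i)
      (hψ.gamma_b i) (hψ.theta_a i) (hψ.theta_b i)) x) _
  · exact mul_eq_zero_iff_mem_dualQuat (hm.quatPair i) (hψ.quatPair_invMap i (gp0 i) x) _

end Duality

end QuaternionCode
end

/-! ### The theorem. -/

open QuaternionCode in
theorem theorem4p8 {F K : Type*} [Field F] [Fintype F] [Field K] [Algebra F K]
    (n : ℕ) (hn : Odd n) (hchar : ¬ ringChar F ∣ 4 * n) (hq : Fintype.card F ≡ 3 [MOD 4])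
    (fx : RecipFactorization F K (X - 1) (X ^ n - 1))
    (gx : RecipFactorization F K (X + 1) (X ^ n + 1))
    (ι : K) (hι : ι ^ 2 = -1)
    (u v : (j : Fin gx.numSelf) → gx.SelfField j)
    (huv : ∀ j, ¬ 4 ∣ (gx.selfFactor j).natDegree → u j ^ 2 + v j ^ 2 = -1) :
    (∃ ψ : MonoidAlgebra F (QuaternionGroup n) ≃ₐ[F] Decomp fx gx ι,
      IsStandardIso fx gx ι u v ψ) ∧
    ∀ ψ : MonoidAlgebra F (QuaternionGroup n) ≃ₐ[F] Decomp fx gx ι,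
      IsStandardIso fx gx ι u v ψ →
      ∀ (C : Submodule F (Fin (4 * n) → F)) (φ : Fin (4 * n) ≃ QuaternionGroup n),
        IsGroupCodeVia φ C →
        (∃ m : Decomp fx gx ι, IsReducedTuple m ∧
          ψ '' groupAlgebraSet φ C = (tupleIdeal m : Set (Decomp fx gx ι))) ∧
        ∀ m : Decomp fx gx ι, IsReducedTuple m →
          ψ '' groupAlgebraSet φ C = (tupleIdeal m : Set (Decomp fx gx ι)) →
          ψ '' groupAlgebraSet φ (euclideanDual C) =
            (dualTupleIdeal m : Set (Decomp fx gx ι)) := by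
  have h4n : ((4 * n : ℕ) : F) ≠ 0 := fun h => hchar (ringChar.dvd h)
  rw [Nat.cast_mul] at h4n
  have hnF : (n : F) ≠ 0 := right_ne_zero_of_mul h4n
  have h2 : (2 : F) ≠ 0 := by
    have h4 := left_ne_zero_of_mul h4n
    intro h
    apply h4
    rw [show ((4 : ℕ) : F) = 2 * 2 by norm_num, h, mul_zero]
  refine ⟨exists_isStandardIso hn h2 hnF hq fx gx ι hι u v huv, ?_⟩
  intro ψ hψ C φ hC
  refine ⟨?_, fun m hm h => image_euclideanDual_eq hn h2 hnF hq hι huv hψ hC hm h⟩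
  obtain ⟨J, hJ⟩ := exists_ideal_image φ C hC ψ
  obtain ⟨m, hm, rfl⟩ := exists_isReducedTuple J
  exact ⟨m, hm, hJ⟩
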